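/- **Setting.** A feedforward network with $H\ge 0$ hidden layers of sizes $n_1,\dots,n_H$, input dimension $n=n_0$ and one output neuron is given by weights $W_i\in\mathbb R^{n_i\times n_{i-1}}$, biases $b_i\in\mathbb R^{n_i}$, activation functions $\sigma_i:\mathbb R^{n_i}\to\mathbb R^{n_i}$ $(1\le i\le H)$ and output weights $W_{H+1}\in\mathbb R^{1\times n_H}$. It computes $N(x)=W_{H+1}Z_H(x)$, where $Z_0(x)=x$, $Z_i(x)=\sigma_i(\hat Z_i(x))$, $\hat Z_i(x)=W_iZ_{i-1}(x)+b_i$. It belongs to the class $\mathcal F$ if all $\sigma_i$ are Lipschitz continuous, and it is a *differentiable network* if all $\sigma_i$ are continuously differentiable. For an ordered space $E$ of reals, real vectors or real matrices (coordinatewise order), let $\mathbf I E$ be the domain of boxes $[a,b]$, $a\le b$, in $E$ together with $\bot=E$, and for $E=\mathbb R^n$ let $\mathbf K E$ be the domain of non-empty compact subsets of $E$ together with $\bot=E$; both are ordered by reverse inclusion, and $\ll$ is the way-below relation. Their rational bases consist of $\bot$ and, respectively, of the boxes with rational corners and of the finite non-empty unions of boxes with rational corners. The canonical interval extension of $f:E\to\mathbf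 I F$ maps a box $\alpha$ to the smallest element of $\mathbf IF$ that contains $\bigcup_{x\in\alpha}f(x)$; a point-valued $f$ is treated as $x\mapsto\{f(x)\}$. The Clarke gradient is $\partial f(x)=\operatorname{conv}\{\lim_i f'(x_i): x_i\to x,\ f\text{ differentiable at every }x_i\}$. For $f:\mathbb R^m\to\mathbb R$, $\hat L(f)(x)$ is the intersection of all $b\in\mathbf I\mathbb R^m$ for which there is an open $O\ni x$ with $f(u)-f(v)\in\{\xi\cdot(u-v):\xi\in b\}$ for all $u,v\in O$; for vector-valued $f$, $\hat L(f)(x)$ is the interval matrix with rows $\hat L(f_i)(x)$. The interval chain-rule approximation $\tilde L(N):\mathbf I\mathbb R^n\to\mathbf I\mathbb R^n$ is $\tilde L(N)(\alpha)=W_{H+1}\times D_H(\alpha)$, where $D_0(\alpha)$ is the identity matrix and $D_i(\alpha)=\hat L(\sigma_i)(\hat Z_i(\alpha))\times(W_i\times D_{i-1}(\alpha))$, with products of interval matrices and with $\hat Z_i(\alpha)$ and $\hat L(\sigma_i)(\hat Z_i(\alpha))$ evaluated layer by layer through canonical interval extensions. For a function $f$ with real intervals $f(x)=[\underline f(x),\overline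 f(x)]$ as values, put $\mathrm{maxV}(f,X)=[\sup_X\underline f,\ \sup_X\overline f]$ and $\mathrm{maxS}(f,X)=\{x\in X: f(x)\cap \mathrm{maxV}(f,X)\ne\emptyset\}$. For the set-valued maps $\partial N$ and $\tilde L(N)$, these are understood for the interval functions $x\mapsto\|\partial N(x)\|_1=\{\|\xi\|_1:\xi\in\partial N(x)\}$ and $x\mapsto\|\tilde L(N)(\{x\})\|_1$, likewise. **Theorem.** (1) Let $N\in\mathcal F$ be a differentiable network, $M>0$, and let $X\subseteq[-M,M]^n$ be non-empty and compact. Then $$\mathrm{maxV}(\partial N,X)=\mathrm{maxV}(\tilde L(N),X),\qquad \mathrm{maxS}(\partial N,X)=\mathrm{maxS}(\tilde L(N),X).$$ (2) Both can be obtained effectively to any degree of accuracy: there are two effective procedures (enumeration operators with recursively enumerable graphs) such that, for every differentiable network $N\in\mathcal F$, every $M>0$ and every finite non-empty union $X\subseteq[-M,M]^n$ of hyperboxes with rational corners, the following holds. The procedures are given the layer sizes $n_0,\dots,n_H$, a code of $X$, and any enumeration of the finite approximations of the data of $N$, namely: for each weight and bias $r$, the basis elements $e\ll\{r\}$ of $\mathbf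 I\mathbb R$; for each $i$, the pairs $(d,e)$ of basis elements with $e\ll\sigma_i(d)$, and those with $e\ll\hat L(\sigma_i)(d)$ (canonical interval extensions). Then $\mathrm{maxV}(\partial N,X)\in\mathbf I\mathbb R$ and $\mathrm{maxS}(\partial N,X)\in\mathbf K\mathbb R^n$; the first procedure enumerates exactly the rational basis elements $e$ of $\mathbf I\mathbb R$ with $e\ll\mathrm{maxV}(\partial N,X)$, and the second one exactly the rational basis elements $C$ of $\mathbf K\mathbb R^n$ with $C\ll\mathrm{maxS}(\partial N,X)$. For every $\varepsilon>0$ there are among them an interval of width less than $\varepsilon$ and a set $C$ contained in the open $\varepsilon$-neighbourhood of $\mathrm{maxS}(\partial N,X)$. -/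

import Mathlib

namespace LipNet

open Set Filter Topology

/-! ## Domain theory -/

/-- The way-below relation `x ≪ y` of a partial order: whenever `y` lies below the supremum of a
directed set, `x` lies below some element of that set. -/
def WayBelow {D : Type*} [PartialOrder D] (x y : D) : Prop :=
  ∀ S : Set D, S.Nonempty → DirectedOn (· ≤ ·) S → ∀ s : D, IsLUB S s → y ≤ s → ∃ d ∈ S, x ≤ d

/-- The interval (hyperbox) domain over `E`: the boxes `[a, b]` with `a ≤ b`, and all of `E` as
bottom element. For `E = Fin n → ℝ` with its coordinatewise order, `Set.Icc a b` is the hyperbox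
`∏ i, [a i, b i]`; for `E = Fin k → Fin m → ℝ` it is an interval matrix. -/
@[ext]
structure IDom (E : Type*) [PartialOrder E] where
  carrier : Set E
  isBox : carrier = univ ∨ ∃ a b : E, a ≤ b ∧ carrier = Icc a b

/-- The domain of non-empty compact subsets of `E`, with all of `E` as bottom element. -/
@[ext]
structure KDom (E : Type*) [TopologicalSpace E] where
  carrier : Set E
  isCompactOrBot : carrier = univ ∨ (carrier.Nonempty ∧ IsCompact carrier)

/-- Reverse inclusion: `x ≤ y` iff `y ⊆ x` (`y` carries more information). -/
instance IDom.instPartialOrder {E : Type*} [PartialOrder E] : PartialOrder (IDom E) where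
  le x y := y.carrier ⊆ x.carrier
  le_refl x := Subset.refl x.carrier
  le_trans _ _ _ h₁ h₂ := Subset.trans h₂ h₁
  le_antisymm _ _ h₁ h₂ := IDom.ext (Subset.antisymm h₂ h₁)

/-- Reverse inclusion: `x ≤ y` iff `y ⊆ x` (`y` carries more information). -/
instance KDom.instPartialOrder {E : Type*} [TopologicalSpace E] : PartialOrder (KDom E) where
  le x y := y.carrier ⊆ x.carrier
  le_refl x := Subset.refl x.carrier
  le_trans _ _ _ h₁ h₂ := Subset.trans h₂ h₁
  le_antisymm _ _ h₁ h₂ := KDom.ext (Subset.antisymm h₂ h₁)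

namespace IDom

/-- The bottom element, i.e. the whole space. -/
def bot (E : Type*) [PartialOrder E] : IDom E := ⟨univ, Or.inl rfl⟩

/-- The maximal element `{x}`. -/
def point {E : Type*} [PartialOrder E] (x : E) : IDom E :=
  ⟨{x}, Or.inr ⟨x, x, le_rfl, (Icc_self x).symm⟩⟩

open Classical in
/-- The hyperbox closure of a non-empty set: the smallest element of the interval domain that
contains it, which is `[inf S, sup S]` if `S` is bounded, and the bottom element otherwise. -/
noncomputable def hull {E : Type*} [ConditionallyCompleteLattice E] (S : Set E) : IDom E :=
  if h : S.Nonempty ∧ BddBelow S ∧ BddAbove S then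
    ⟨Icc (sInf S) (sSup S), Or.inr ⟨sInf S, sSup S, csInf_le_csSup h.1 h.2.1 h.2.2, rfl⟩⟩
  else bot E

/-- The canonical interval extension of an interval-valued function `f`: it maps a box `α` to the
greatest lower bound of the values `f x` with `x ∈ α`, i.e. to the hyperbox closure of their
union. -/
noncomputable def extend {E F : Type*} [PartialOrder E] [ConditionallyCompleteLattice F]
    (f : E → IDom F) (α : IDom E) : IDom F :=
  hull (⋃ x ∈ α.carrier, (f x).carrier)

/-- The canonical interval extension of a point-valued function. For an affine function this is
its evaluation in interval arithmetic. -/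
noncomputable def map {E F : Type*} [PartialOrder E] [ConditionallyCompleteLattice F]
    (f : E → F) (α : IDom E) : IDom F :=
  extend (fun x => point (f x)) α

end IDom

/-! ## Derivatives -/

/-- The vector of partial derivatives of `f` at `y` (used only where `f` is differentiable). -/
noncomputable def gradVec {n : ℕ} (f : (Fin n → ℝ) → ℝ) (y : Fin n → ℝ) : Fin n → ℝ :=
  fun j => fderiv ℝ f y (Pi.single j 1)

/-- The Clarke gradient of a (locally Lipschitz) function on `ℝⁿ`: the convex hull of all limits
of gradients along sequences of points of differentiability that converge to `x`. -/
def clarke {n : ℕ} (f : (Fin n → ℝ) → ℝ) (x : Fin n → ℝ) : Set (Fin n → ℝ) :=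
  convexHull ℝ {ξ | ∃ u : ℕ → Fin n → ℝ, Tendsto u atTop (𝓝 x) ∧
    (∀ i, DifferentiableAt ℝ f (u i)) ∧ Tendsto (fun i => gradVec f (u i)) atTop (𝓝 ξ)}

/-- The single-step tie `f ∈ δ(O, b)`: for all `x, y ∈ O`, the number `f x - f y` belongs to
`{ξ ⬝ (x - y) | ξ ∈ b}`. -/
def Tie {n : ℕ} (O : Set (Fin n → ℝ)) (b : IDom (Fin n → ℝ)) (f : (Fin n → ℝ) → ℝ) : Prop :=
  ∀ x ∈ O, ∀ y ∈ O, ∃ ξ ∈ b.carrier, f x - f y = ∑ j, ξ j * (x j - y j)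

/-- The `L̂`-derivative of a real-valued function at `x`: the supremum of all hyperboxes `b` with
`f ∈ δ(O, b)` for some open `O` that contains `x`. The supremum is the intersection; this is an
element of the interval domain as soon as it is non-empty, and then `hull` does not change it. -/
noncomputable def Lhat {n : ℕ} (f : (Fin n → ℝ) → ℝ) (x : Fin n → ℝ) : IDom (Fin n → ℝ) :=
  IDom.hull (⋂₀ {B | ∃ (b : IDom (Fin n → ℝ)) (O : Set (Fin n → ℝ)),
    IsOpen O ∧ x ∈ O ∧ Tie O b f ∧ B = b.carrier})

/-- The `L̂`-derivative of a vector-valued function: the interval matrix with rows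
`L̂(f₁)(x), …, L̂(fₖ)(x)`. -/
noncomputable def LhatVec {m k : ℕ} (f : (Fin m → ℝ) → (Fin k → ℝ)) (x : Fin m → ℝ) :
    IDom (Fin k → Fin m → ℝ) :=
  IDom.hull {A | ∀ i, A i ∈ (Lhat (fun y => f y i) x).carrier}

/-- Product of interval matrices: the smallest interval matrix that contains all products `A * B`.
Its entries are the sums `∑ j, 𝐀 i j * 𝐁 j l` of interval arithmetic, because every entry of
`A` and of `B` ranges over its interval independently of the others. -/
noncomputable def imatMul {k m n : ℕ} (P : IDom (Fin k → Fin m → ℝ))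
    (Q : IDom (Fin m → Fin n → ℝ)) : IDom (Fin k → Fin n → ℝ) :=
  IDom.hull (image2 (fun A B => fun i l => ∑ j, A i j * B j l) P.carrier Q.carrier)

/-! ## Feedforward networks -/

/-- A feedforward network with `H` hidden layers and one output neuron. `w 0` is the dimension of
the input and `w i` the number of neurons of the `i`-th hidden layer, for `1 ≤ i ≤ H`. The data of
the `(i + 1)`-st hidden layer carry the index `i : Fin H`. -/
structure Network (H : ℕ) (w : ℕ → ℕ) where
  /-- weights -/
  W : ∀ i : Fin H, Fin (w (i + 1)) → Fin (w i) → ℝ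
  /-- biases -/
  b : ∀ i : Fin H, Fin (w (i + 1)) → ℝ
  /-- activation functions, as vector fields -/
  σ : ∀ i : Fin H, (Fin (w (i + 1)) → ℝ) → (Fin (w (i + 1)) → ℝ)
  /-- weights from the last hidden layer to the output neuron -/
  Wout : Fin (w H) → ℝ

namespace Network

variable {H : ℕ} {w : ℕ → ℕ}

/-- The affine part `z ↦ W z + b` of a layer. -/
def affine (N : Network H w) (i : Fin H) (z : Fin (w i) → ℝ) : Fin (w (i + 1)) → ℝ :=
  fun r => ∑ c, N.W i r c * z c + N.b i r

/-- The output `Z i` of the `i`-th layer (`i = 0` is the input). -/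
def Z (N : Network H w) : ∀ i : ℕ, i ≤ H → (Fin (w 0) → ℝ) → (Fin (w i) → ℝ)
  | 0, _, x => x
  | i + 1, h, x => N.σ ⟨i, h⟩ (N.affine ⟨i, h⟩ (N.Z i (Nat.le_of_succ_le h) x))

/-- The function computed by the network. -/
def toFun (N : Network H w) (x : Fin (w 0) → ℝ) : ℝ :=
  ∑ r, N.Wout r * N.Z H le_rfl x r

/-- The class `𝓕`: all activation functions are Lipschitz continuous. -/
def InF (N : Network H w) : Prop :=
  ∀ i : Fin H, ∃ K : NNReal, LipschitzWith K (N.σ i)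

/-- A differentiable network: all activation functions are continuously differentiable. -/
def IsDifferentiable (N : Network H w) : Prop :=
  ∀ i : Fin H, ContDiff ℝ 1 (N.σ i)

/-- Interval evaluation of the layers. -/
noncomputable def intervalZ (N : Network H w) :
    ∀ i : ℕ, i ≤ H → IDom (Fin (w 0) → ℝ) → IDom (Fin (w i) → ℝ)
  | 0, _, α => α
  | i + 1, h, α => IDom.map (N.σ ⟨i, h⟩)
      (IDom.map (N.affine ⟨i, h⟩) (N.intervalZ i (Nat.le_of_succ_le h) α))

/-- Interval enclosure of the derivative of the `i`-th layer with respect to the input, by the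
chain rule on hyperboxes: the enclosure for `σ ∘ affine ∘ Z` is
`L̂(σ)(affine (Z α)) × (W × (enclosure for Z))`. -/
noncomputable def intervalDZ (N : Network H w) :
    ∀ i : ℕ, i ≤ H → IDom (Fin (w 0) → ℝ) → IDom (Fin (w i) → Fin (w 0) → ℝ)
  | 0, _, _ => IDom.point (fun r c => if r = c then 1 else 0)
  | i + 1, h, α =>
      imatMul
        (IDom.extend (LhatVec (N.σ ⟨i, h⟩))
          (IDom.map (N.affine ⟨i, h⟩) (N.intervalZ i (Nat.le_of_succ_le h) α)))
        (imatMul (IDom.point (N.W ⟨i, h⟩)) (N.intervalDZ i (Nat.le_of_succ_le h) α))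

/-- The interval chain-rule approximation `L̃(N)` of the `L̂`-derivative of the network. The last
step is the product of the row vector `Wout` with the enclosure for the last hidden layer. -/
noncomputable def Ltilde (N : Network H w) (α : IDom (Fin (w 0) → ℝ)) : IDom (Fin (w 0) → ℝ) :=
  IDom.map (fun (A : Fin (w H) → Fin (w 0) → ℝ) c => ∑ r, N.Wout r * A r c)
    (N.intervalDZ H le_rfl α)

end Network

/-! ## Maximum value and maximum set -/

/-- The set of the `1`-norms of the elements of `G`. For a hyperbox `∏ j, I j` this is the interval
sum `∑ j, |I j|` of the intervals `|I j| = {|t| : t ∈ I j}`. -/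
def norm1 {n : ℕ} (G : Set (Fin n → ℝ)) : Set ℝ :=
  (fun ξ => ∑ j, |ξ j|) '' G

/-- Lower end point of an interval. -/
noncomputable def lowerEnd (I : Set ℝ) : EReal := ⨅ t ∈ I, (t : EReal)

/-- Upper end point of an interval. -/
noncomputable def upperEnd (I : Set ℝ) : EReal := ⨆ t ∈ I, (t : EReal)

/-- The maximum value of an interval-valued function over `X`: the interval whose end points are
the supremum of the lower end points and the supremum of the upper end points. -/
def maxV {E : Type*} (f : E → Set ℝ) (X : Set E) : Set ℝ :=
  {t : ℝ | (⨆ x ∈ X, lowerEnd (f x)) ≤ (t : EReal) ∧ (t : EReal) ≤ ⨆ x ∈ X, upperEnd (f x)}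

/-- The maximum set of an interval-valued function over `X`. -/
def maxS {E : Type*} (f : E → Set ℝ) (X : Set E) : Set E :=
  {x ∈ X | (f x ∩ maxV f X).Nonempty}

namespace Network

variable {H : ℕ} {w : ℕ → ℕ}

/-- `x ↦ ‖∂N(x)‖₁`. -/
def clarkeNorm (N : Network H w) (x : Fin (w 0) → ℝ) : Set ℝ :=
  norm1 (clarke N.toFun x)

/-- `x ↦ ‖L̃(N)({x})‖₁`, the restriction of `‖L̃(N)‖₁` to the maximal elements. -/
noncomputable def LtildeNorm (N : Network H w) (x : Fin (w 0) → ℝ) : Set ℝ :=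
  norm1 (N.Ltilde (IDom.point x)).carrier

end Network

/-! ## Enumerated rational bases -/

/-- Codes of rational numbers: `(a, b, c)` stands for `(a - b) / (c + 1)`. -/
abbrev RatCode := ℕ × ℕ × ℕ

/-- The rational number with a given code, as a real number. -/
noncomputable def ratVal (q : RatCode) : ℝ := ((q.1 : ℝ) - (q.2.1 : ℝ)) / ((q.2.2 : ℝ) + 1)

/-- The rational point of `ℝⁿ` with a given code (missing coordinates are `0`, superfluous ones
are ignored). -/
noncomputable def vecVal (n : ℕ) (l : List RatCode) : Fin n → ℝ :=
  fun i => ratVal (l.getD i (0, 0, 0))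

/-- The rational matrix with a given code, which lists the entries row by row. -/
noncomputable def matVal (k m : ℕ) (l : List RatCode) : Fin k → Fin m → ℝ :=
  fun i j => ratVal (l.getD (i * m + j) (0, 0, 0))

/-- The element of the rational basis of the interval domain with a given code: `none` stands for
the bottom element, a pair of codes for the box spanned by the two points, i.e. the box whose
corners are their infimum and their supremum. -/
def boxVal {C E : Type*} [Lattice E] (dec : C → E) : Option (C × C) → IDom E
  | none => IDom.bot E
  | some p => ⟨uIcc (dec p.1) (dec p.2), Or.inr ⟨_, _, inf_le_sup, rfl⟩⟩

/-- Codes of the rational basis of the domain of real intervals. -/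
abbrev IntervalCode := Option (RatCode × RatCode)

/-- Codes of the rational bases of the domains of hyperboxes and of interval matrices. -/
abbrev BoxCode := Option (List RatCode × List RatCode)

/-- Codes of finite non-empty unions of rational hyperboxes (first box, further boxes). -/
abbrev UnionCode := (List RatCode × List RatCode) × List (List RatCode × List RatCode)

/-- The finite union of rational hyperboxes with a given code. -/
def unionVal (n : ℕ) (c : UnionCode) : Set (Fin n → ℝ) :=
  ⋃ p ∈ c.1 :: c.2, uIcc (vecVal n p.1) (vecVal n p.2)

theorem unionVal_nonempty (n : ℕ) (c : UnionCode) : (unionVal n c).Nonempty :=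
  ⟨vecVal n c.1.1, mem_iUnion₂.2 ⟨c.1, List.mem_cons_self, left_mem_uIcc⟩⟩

theorem isCompact_unionVal (n : ℕ) (c : UnionCode) : IsCompact (unionVal n c) :=
  (List.finite_toSet (c.1 :: c.2)).isCompact_biUnion fun _ _ => isCompact_Icc

/-- The element of the basis of the domain of compact sets with a given code: the whole space or a
finite union of rational hyperboxes. -/
def compactVal (n : ℕ) : Option UnionCode → KDom (Fin n → ℝ)
  | none => ⟨univ, Or.inl rfl⟩
  | some c => ⟨unionVal n c, Or.inr ⟨unionVal_nonempty n c, isCompact_unionVal n c⟩⟩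

/-! ## Effective procedures -/

/-- The set enumerated from (any enumeration of) the set `A` by the enumeration operator with graph
`R`: the element `q` is put out as soon as, for some `(D, q)` in the graph, all members of the
finite list `D` have been read. -/
def outputs {F Q : Type*} (R : List F × Q → Prop) (A : Set F) : Set Q :=
  {q | ∃ D : List F, (∀ f ∈ D, f ∈ A) ∧ R (D, q)}

/-- Finite pieces of information about a network. In the order of the summands: approximations of
a weight (layer, row, column, interval), of a bias (layer, row, interval), of an output weight
(index, interval), of an activation function (layer, box of arguments, box of values), and of the
`L̂`-derivative of an activation function (layer, box of arguments, interval matrix of values). -/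
abbrev Fact :=
  (ℕ × ℕ × ℕ × IntervalCode) ⊕ (ℕ × ℕ × IntervalCode) ⊕ (ℕ × IntervalCode) ⊕
    (ℕ × BoxCode × BoxCode) ⊕ (ℕ × BoxCode × BoxCode)

instance : Primcodable Fact := inferInstance

instance : Primcodable UnionCode := inferInstance

/-- All pieces of information about a network. A real number `r` is given by the rational intervals
way below `{r}`. The activation functions and their `L̂`-derivatives are given through their
canonical interval extensions `u`, by the pairs of basis elements `d`, `e` with `e ≪ u d`. -/
def Network.info {H : ℕ} {w : ℕ → ℕ} (N : Network H w) : Set Fact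
  | .inl (i, r, c, e) => ∃ (hi : i < H) (hr : r < w (i + 1)) (hc : c < w i),
      WayBelow (boxVal ratVal e) (IDom.point (N.W ⟨i, hi⟩ ⟨r, hr⟩ ⟨c, hc⟩))
  | .inr (.inl (i, r, e)) => ∃ (hi : i < H) (hr : r < w (i + 1)),
      WayBelow (boxVal ratVal e) (IDom.point (N.b ⟨i, hi⟩ ⟨r, hr⟩))
  | .inr (.inr (.inl (r, e))) => ∃ hr : r < w H,
      WayBelow (boxVal ratVal e) (IDom.point (N.Wout ⟨r, hr⟩))
  | .inr (.inr (.inr (.inl (i, d, e)))) => ∃ hi : i < H,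
      WayBelow (boxVal (vecVal (w (i + 1))) e)
        (IDom.map (N.σ ⟨i, hi⟩) (boxVal (vecVal (w (i + 1))) d))
  | .inr (.inr (.inr (.inr (i, d, e)))) => ∃ hi : i < H,
      WayBelow (boxVal (matVal (w (i + 1)) (w (i + 1))) e)
        (IDom.extend (LhatVec (N.σ ⟨i, hi⟩)) (boxVal (vecVal (w (i + 1))) d))

/-- The list `[w 0, …, w H]` of the layer sizes. -/
def arch (H : ℕ) (w : ℕ → ℕ) : List ℕ := (List.range (H + 1)).map w

end LipNet

namespace LipNet

open Set Filter Topology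

/-! ## Gradients of continuously differentiable functions -/

/-! With continuously differentiable activations the network function is C¹, so its Clarke gradient
at `x` is the single vector `∇N(x)` (`clarke_eq_singleton`). The mean value theorem shows that
`L̂(σ)` is the Jacobian matrix, again a single value (`Lhat_eq_point`). Interval arithmetic on point
intervals is exact, so the chain rule gives `L̃(N)({x}) = {∇N(x)}`
(`IsDifferentiable.Ltilde_point`). Both interval functions are therefore the continuous real
function `φ(x) = ‖∇N(x)‖₁`. This gives (1). Over a compact `X` the maximum value is the point `max
φ` and the maximum set is the compact set of maximisers.

For (2), `e ≪ {m}` means that `m` is interior to `e`, and `C ≪ K` means that `K` lies in the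
interior of `C`. Both relations turn out to be witnessed by finite certificates. A certificate
encloses `φ` on rational boxes by interval arithmetic from finitely many facts about the network. It
contains a rational point of `X`, which bounds `max φ` from below, and a finite cover of `X` by
boxes. For the value, all boxes have upper bounds below the right end of `e`. For the set, each box
either has an upper bound below the value at the point, hence holds no maximiser, or lies strictly
inside a larger box contained in `C`.

Soundness is `certifies_sound`. Completeness is `exists_certifies`, where continuity makes the
enclosures arbitrarily sharp, combined with compactness of `X`. Inclusions between unions of
rational boxes are decided on a finite grid (`Cover`). Checking a certificate is primitive
recursive, so its existence is recursively enumerable, and a certificate uses only finitely many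
facts (`Finitary`). Hence the two graphs define enumeration operators. -/

theorem fderiv_apply_eq_sum_gradVec {n : ℕ} (f : (Fin n → ℝ) → ℝ) (y v : Fin n → ℝ) :
    fderiv ℝ f y v = ∑ j, gradVec f y j * v j := by
  have hv : v = ∑ j, v j • (Pi.single j 1 : Fin n → ℝ) := by
    ext k; simp [Finset.sum_apply, Pi.single_apply]
  conv_lhs => rw [hv, map_sum]
  simp [gradVec, mul_comm]

theorem continuous_gradVec {n : ℕ} {f : (Fin n → ℝ) → ℝ} (hf : ContDiff ℝ 1 f) :
    Continuous (gradVec f) :=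
  continuous_pi fun _ => (hf.continuous_fderiv one_ne_zero).clm_apply continuous_const

theorem clarke_eq_singleton {n : ℕ} {f : (Fin n → ℝ) → ℝ} (hf : ContDiff ℝ 1 f)
    (x : Fin n → ℝ) : clarke f x = {gradVec f x} := by
  have h : {ξ | ∃ u : ℕ → Fin n → ℝ, Tendsto u atTop (𝓝 x) ∧
      (∀ i, DifferentiableAt ℝ f (u i)) ∧ Tendsto (fun i => gradVec f (u i)) atTop (𝓝 ξ)} =
      {gradVec f x} := by
    ext ξ
    constructor
    · rintro ⟨u, hu, -, hξ⟩
      exact tendsto_nhds_unique hξ (((continuous_gradVec hf).tendsto x).comp hu)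
    · rintro rfl
      exact ⟨fun _ => x, tendsto_const_nhds,
        fun _ => (hf.differentiable one_ne_zero).differentiableAt, tendsto_const_nhds⟩
  rw [clarke, h, convexHull_singleton]

/-- A tie forces the difference quotients along the `j`-th axis into the `j`-th side of the box;
this side is closed, so it contains their limit. Working coordinate by coordinate suffices because
`b` is a box. -/
theorem gradVec_mem_of_tie {n : ℕ} {f : (Fin n → ℝ) → ℝ} (hf : Differentiable ℝ f)
    {x : Fin n → ℝ} {O : Set (Fin n → ℝ)} (hO : IsOpen O) (hx : x ∈ O)
    {b : IDom (Fin n → ℝ)} (hb : Tie O b f) : gradVec f x ∈ b.carrier := by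
  rcases b.isBox with h | ⟨p, q, -, h⟩
  · simp [h]
  have key : ∀ j, gradVec f x j ∈ Icc (p j) (q j) := by
    intro j
    have hd : HasDerivAt (fun t : ℝ => f (x + t • Pi.single j 1)) (gradVec f x j) 0 := by
      have h1 : HasDerivAt (fun t : ℝ => x + t • (Pi.single j 1 : Fin n → ℝ))
          (Pi.single j 1) 0 := by
        simpa using ((hasDerivAt_id (0 : ℝ)).smul_const (Pi.single j 1 : Fin n → ℝ)).const_add x
      have h2 : HasFDerivAt f (fderiv ℝ f x) (x + (0 : ℝ) • (Pi.single j 1 : Fin n → ℝ)) := by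
        simpa using (hf x).hasFDerivAt
      exact h2.comp_hasDerivAt 0 h1
    rw [hasDerivAt_iff_tendsto_slope] at hd
    refine isClosed_Icc.mem_of_tendsto hd ?_
    have hc : Continuous fun t : ℝ => x + t • (Pi.single j 1 : Fin n → ℝ) := by fun_prop
    have hO' : ∀ᶠ t : ℝ in 𝓝 0, x + t • (Pi.single j 1 : Fin n → ℝ) ∈ O :=
      hc.continuousAt.eventually (hO.mem_nhds (by simpa using hx))
    filter_upwards [nhdsWithin_le_nhds hO', self_mem_nhdsWithin] with t ht ht0
    obtain ⟨ξ, hξ, he⟩ := hb _ ht x hx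
    rw [h] at hξ
    have ht0' : t ≠ 0 := ht0
    -- The two points differ only in coordinate `j`, by `t`, so the tie equation reduces to `ξ j *
    -- t`.
    have : slope (fun t : ℝ => f (x + t • Pi.single j 1)) 0 t = ξ j := by
      simp only [slope_def_field, zero_smul, add_zero, sub_zero, he]
      simp [Pi.single_apply, ht0']
    rw [this]
    exact ⟨hξ.1 j, hξ.2 j⟩
  rw [h]
  exact ⟨fun j => (key j).1, fun j => (key j).2⟩

/-- By the mean value theorem, `ξ` can be taken as the gradient at a point of the segment between
the two points; convexity keeps that point in `O`. -/
theorem tie_of_gradVec_mem {n : ℕ} {f : (Fin n → ℝ) → ℝ} (hf : Differentiable ℝ f)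
    {O : Set (Fin n → ℝ)} (hO : Convex ℝ O) {b : IDom (Fin n → ℝ)}
    (hb : ∀ y ∈ O, gradVec f y ∈ b.carrier) : Tie O b f := by
  intro x hx y hy
  obtain ⟨z, hz, he⟩ := domain_mvt (f := f) (f' := fun z => fderiv ℝ f z) (s := O)
    (fun z _ => (hf z).hasFDerivAt.hasFDerivWithinAt) hO hy hx
  refine ⟨gradVec f z, hb z (hO.segment_subset hy hx hz), ?_⟩
  rw [he, fderiv_apply_eq_sum_gradVec]
  rfl

/-! ### Exactness on point intervals, and the `L̂`-derivative of a C¹ function -/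

theorem IDom.hull_singleton {E : Type*} [ConditionallyCompleteLattice E] (x : E) :
    IDom.hull {x} = IDom.point x := by
  ext1
  simp [IDom.hull, IDom.point]

theorem IDom.extend_point {E F : Type*} [PartialOrder E] [ConditionallyCompleteLattice F]
    (f : E → F) (x : E) : IDom.extend (fun y => IDom.point (f y)) (IDom.point x) =
      IDom.point (f x) := by
  rw [IDom.extend]
  simp only [IDom.point, mem_singleton_iff, iUnion_iUnion_eq_left]
  exact IDom.hull_singleton (f x)

theorem IDom.map_point {E F : Type*} [PartialOrder E] [ConditionallyCompleteLattice F]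
    (f : E → F) (x : E) : IDom.map f (IDom.point x) = IDom.point (f x) :=
  IDom.extend_point f x

theorem imatMul_point {k m n : ℕ} (A : Fin k → Fin m → ℝ) (B : Fin m → Fin n → ℝ) :
    imatMul (IDom.point A) (IDom.point B) = IDom.point fun i l => ∑ j, A i j * B j l := by
  rw [imatMul]
  simp only [IDom.point, image2_singleton]
  exact IDom.hull_singleton _

/-- Every tie around `x` contains the gradient at `x`. Conversely, by continuity of the gradient,
the box of radius `ε` around it is a tie on a small ball, so the intersection of all ties is no
larger than the gradient. -/
theorem Lhat_eq_point {n : ℕ} {f : (Fin n → ℝ) → ℝ} (hf : ContDiff ℝ 1 f) (x : Fin n → ℝ) :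
    Lhat f x = IDom.point (gradVec f x) := by
  have hd := hf.differentiable one_ne_zero
  rw [Lhat, ← IDom.hull_singleton]
  congr 1
  refine Subset.antisymm ?_ ?_
  · intro ξ hξ
    have key : ∀ ε > 0, ∀ j, |ξ j - gradVec f x j| ≤ ε := by
      intro ε hε j
      obtain ⟨δ, hδ, hball⟩ := Metric.continuousAt_iff.1 (continuous_gradVec hf).continuousAt ε hε
      have hle : (gradVec f x - fun _ => ε) ≤ gradVec f x + fun _ => ε := by
        intro j; simp; linarith
      have hm := hξ (Icc (gradVec f x - fun _ => ε) (gradVec f x + fun _ => ε))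
        ⟨⟨_, Or.inr ⟨_, _, hle, rfl⟩⟩, Metric.ball x δ, Metric.isOpen_ball,
          Metric.mem_ball_self hδ, tie_of_gradVec_mem hd (convex_ball x δ) ?_, rfl⟩
      · have h1 := hm.1 j
        have h2 := hm.2 j
        simp only [Pi.sub_apply, Pi.add_apply] at h1 h2
        rw [abs_le]; constructor <;> linarith
      · intro y hy
        have h1 : ∀ k, |gradVec f y k - gradVec f x k| < ε := fun k =>
          lt_of_le_of_lt (dist_le_pi_dist (gradVec f y) (gradVec f x) k) (hball hy)
        constructor <;> intro k <;> have := abs_lt.1 (h1 k) <;>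
          simp only [Pi.sub_apply, Pi.add_apply] <;> linarith
    rw [mem_singleton_iff]
    ext j
    have : |ξ j - gradVec f x j| ≤ 0 := le_of_forall_gt_imp_ge_of_dense fun ε hε => key ε hε j
    exact sub_eq_zero.1 (abs_nonpos_iff.1 this)
  · rintro _ rfl B ⟨b, O, hO, hx, hT, rfl⟩
    exact gradVec_mem_of_tie hd hO hx hT

/-- The Jacobian matrix of a vector-valued function. -/
noncomputable def jacMat {m k : ℕ} (f : (Fin m → ℝ) → (Fin k → ℝ)) (x : Fin m → ℝ) :
    Fin k → Fin m → ℝ :=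
  fun i => gradVec (fun y => f y i) x

theorem continuous_jacMat {m k : ℕ} {f : (Fin m → ℝ) → (Fin k → ℝ)} (hf : ContDiff ℝ 1 f) :
    Continuous (jacMat f) :=
  continuous_pi fun i => continuous_gradVec (contDiff_pi.1 hf i)

theorem LhatVec_eq_point {m k : ℕ} {f : (Fin m → ℝ) → (Fin k → ℝ)} (hf : ContDiff ℝ 1 f) :
    LhatVec f = fun x => IDom.point (jacMat f x) := by
  funext x
  rw [LhatVec, ← IDom.hull_singleton]
  congr 1
  ext A
  simp only [mem_ofPred_eq, mem_singleton_iff]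
  rw [funext_iff]
  refine forall_congr' fun i => ?_
  rw [Lhat_eq_point (contDiff_pi.1 hf i)]
  rfl

/-! ## The gradient of a differentiable network -/

namespace Network

variable {H : ℕ} {w : ℕ → ℕ}

/-- The Jacobian matrix of the `i`-th layer with respect to the input, by the chain rule. -/
noncomputable def jac (N : Network H w) :
    ∀ i : ℕ, i ≤ H → (Fin (w 0) → ℝ) → Fin (w i) → Fin (w 0) → ℝ
  | 0, _, _ => fun r c => if r = c then 1 else 0
  | i + 1, h, x => fun r l =>
      ∑ j, jacMat (N.σ ⟨i, h⟩) (N.affine ⟨i, h⟩ (N.Z i (Nat.le_of_succ_le h) x)) r j *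
        ∑ c, N.W ⟨i, h⟩ j c * N.jac i (Nat.le_of_succ_le h) x c l

/-- The gradient of the network, by the chain rule. -/
noncomputable def grad (N : Network H w) (x : Fin (w 0) → ℝ) : Fin (w 0) → ℝ :=
  fun l => ∑ r, N.Wout r * N.jac H le_rfl x r l

theorem contDiff_affine (N : Network H w) (i : Fin H) : ContDiff ℝ 1 (N.affine i) := by
  unfold affine
  fun_prop

theorem IsDifferentiable.contDiff_Z {N : Network H w} (hN : N.IsDifferentiable) :
    ∀ (i : ℕ) (h : i ≤ H), ContDiff ℝ 1 (N.Z i h)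
  | 0, _ => contDiff_id
  | i + 1, h => (hN ⟨i, h⟩).comp ((N.contDiff_affine ⟨i, h⟩).comp
      (hN.contDiff_Z i (Nat.le_of_succ_le h)))

theorem IsDifferentiable.contDiff_toFun {N : Network H w} (hN : N.IsDifferentiable) :
    ContDiff ℝ 1 N.toFun := by
  have := hN.contDiff_Z H le_rfl
  rw [contDiff_pi] at this
  unfold toFun
  fun_prop

/-- The constant `b` lets one formula serve the hidden affine layers, with their bias, and the
output layer, with `b = 0`. -/
theorem gradVec_sum_mul {n m : ℕ} (a : Fin m → ℝ) (b : ℝ) {g : Fin m → (Fin n → ℝ) → ℝ}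
    (hg : ∀ c, Differentiable ℝ (g c)) (x : Fin n → ℝ) (l : Fin n) :
    gradVec (fun x => ∑ c, a c * g c x + b) x l = ∑ c, a c * gradVec (g c) x l := by
  have h : HasFDerivAt (fun x => ∑ c, a c * g c x + b) (∑ c, a c • fderiv ℝ (g c) x) x :=
    (HasFDerivAt.fun_sum fun c _ => ((hg c x).hasFDerivAt.const_mul (a c))).add_const b
  simp [gradVec, h.fderiv]

theorem IsDifferentiable.jacMat_Z {N : Network H w} (hN : N.IsDifferentiable) :
    ∀ (i : ℕ) (h : i ≤ H) (x : Fin (w 0) → ℝ), jacMat (N.Z i h) x = N.jac i h x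
  | 0, h, x => by
      ext r c
      have : HasFDerivAt (fun y : Fin (w 0) → ℝ => y r)
        (ContinuousLinearMap.proj (R := ℝ) (φ := fun _ : Fin (w 0) => ℝ) r) x := hasFDerivAt_apply r x
      simp only [jacMat, Z, jac, gradVec]
      rw [this.fderiv]
      simp [Pi.single_apply]
  | i + 1, h, x => by
      ext r l
      have hZ := hN.contDiff_Z i (Nat.le_of_succ_le h)
      have hA := (N.contDiff_affine ⟨i, h⟩).comp hZ
      have hs := (contDiff_pi.1 (hN ⟨i, h⟩) r).differentiable one_ne_zero
      have hc : fderiv ℝ (fun y => N.Z (i + 1) h y r) x =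
          (fderiv ℝ (fun y => N.σ ⟨i, h⟩ y r) ((N.affine ⟨i, h⟩ ∘ N.Z i _) x)).comp
            (fderiv ℝ (N.affine ⟨i, h⟩ ∘ N.Z i (Nat.le_of_succ_le h)) x) :=
        fderiv_comp (g := fun y => N.σ ⟨i, h⟩ y r) x (hs _) (hA.differentiable one_ne_zero x)
      simp only [jacMat, gradVec, jac]
      rw [hc, ContinuousLinearMap.comp_apply, fderiv_apply_eq_sum_gradVec]
      refine Finset.sum_congr rfl fun j _ => ?_
      congr 1
      have hd : ∀ c, Differentiable ℝ fun y => N.Z i (Nat.le_of_succ_le h) y c := fun c =>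
        (contDiff_pi.1 hZ c).differentiable one_ne_zero
      have h1 := gradVec_sum_mul (N.W ⟨i, h⟩ j) (N.b ⟨i, h⟩ j) hd x l
      rw [← hN.jacMat_Z i (Nat.le_of_succ_le h) x]
      simp only [jacMat]
      rw [← h1, gradVec]
      -- The chain rule yields coordinates of the derivative of a vector-valued map, whereas
      -- `gradVec` differentiates coordinate functions; `fderiv_pi` identifies the two.
      have hp := fderiv_pi (𝕜 := ℝ) (x := x)
        (φ := fun j y => (N.affine ⟨i, h⟩ ∘ N.Z i (Nat.le_of_succ_le h)) y j)
        (fun j => (contDiff_pi.1 hA j).differentiable one_ne_zero x)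
      have hp' : fderiv ℝ (N.affine ⟨i, h⟩ ∘ N.Z i (Nat.le_of_succ_le h)) x = _ := hp
      rw [hp']
      rfl

theorem IsDifferentiable.gradVec_toFun {N : Network H w} (hN : N.IsDifferentiable)
    (x : Fin (w 0) → ℝ) : gradVec N.toFun x = N.grad x := by
  ext l
  have hd : ∀ c, Differentiable ℝ fun y => N.Z H le_rfl y c := fun c =>
    (contDiff_pi.1 (hN.contDiff_Z H le_rfl) c).differentiable one_ne_zero
  have h1 := gradVec_sum_mul N.Wout 0 hd x l
  simp only [add_zero] at h1
  rw [grad, ← hN.jacMat_Z H le_rfl x]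
  exact h1

theorem IsDifferentiable.continuous_grad {N : Network H w} (hN : N.IsDifferentiable) :
    Continuous N.grad := by
  have := continuous_gradVec hN.contDiff_toFun
  rwa [funext hN.gradVec_toFun] at this

theorem intervalZ_point (N : Network H w) (x : Fin (w 0) → ℝ) :
    ∀ (i : ℕ) (h : i ≤ H), N.intervalZ i h (IDom.point x) = IDom.point (N.Z i h x)
  | 0, _ => rfl
  | i + 1, h => by
      rw [intervalZ, N.intervalZ_point x i, IDom.map_point, IDom.map_point, Z]

/-- On a point interval every hull in the recursion is the hull of a singleton, so no overestimation
occurs and the interval chain rule becomes the ordinary one. -/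
theorem IsDifferentiable.intervalDZ_point {N : Network H w} (hN : N.IsDifferentiable)
    (x : Fin (w 0) → ℝ) :
    ∀ (i : ℕ) (h : i ≤ H), N.intervalDZ i h (IDom.point x) = IDom.point (N.jac i h x)
  | 0, _ => rfl
  | i + 1, h => by
      rw [intervalDZ, N.intervalZ_point, hN.intervalDZ_point x i, IDom.map_point,
        LhatVec_eq_point (hN _), IDom.extend_point, imatMul_point, imatMul_point]
      rfl

theorem IsDifferentiable.Ltilde_point {N : Network H w} (hN : N.IsDifferentiable)
    (x : Fin (w 0) → ℝ) : N.Ltilde (IDom.point x) = IDom.point (N.grad x) := by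
  rw [Ltilde, hN.intervalDZ_point, IDom.map_point]
  rfl

/-- The `1`-norm of the gradient of the network. -/
noncomputable def gradNorm (N : Network H w) (x : Fin (w 0) → ℝ) : ℝ :=
  ∑ l, |N.grad x l|

theorem IsDifferentiable.continuous_gradNorm {N : Network H w} (hN : N.IsDifferentiable) :
    Continuous N.gradNorm := by
  have := hN.continuous_grad
  unfold gradNorm
  fun_prop

theorem IsDifferentiable.clarkeNorm_eq {N : Network H w} (hN : N.IsDifferentiable) :
    N.clarkeNorm = fun x => {N.gradNorm x} := by
  funext x
  rw [clarkeNorm, clarke_eq_singleton hN.contDiff_toFun, hN.gradVec_toFun, norm1, image_singleton]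
  rfl

theorem IsDifferentiable.LtildeNorm_eq {N : Network H w} (hN : N.IsDifferentiable) :
    N.LtildeNorm = fun x => {N.gradNorm x} := by
  funext x
  rw [LtildeNorm, hN.Ltilde_point, norm1]
  exact image_singleton

end Network

/-! ## Maximum value and maximum set of a continuous function -/

theorem maxV_singleton {E : Type*} {φ : E → ℝ} {X : Set E} {y : E} (hy : y ∈ X)
    (hmax : ∀ x ∈ X, φ x ≤ φ y) : maxV (fun x => {φ x}) X = {φ y} := by
  have h : (⨆ x ∈ X, (φ x : EReal)) = (φ y : EReal) :=
    le_antisymm (iSup₂_le fun x hx => EReal.coe_le_coe_iff.2 (hmax x hx))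
      (le_iSup₂ (f := fun x (_ : x ∈ X) => (φ x : EReal)) y hy)
  ext t
  simp only [maxV, lowerEnd, upperEnd, mem_singleton_iff, iInf_iInf_eq_left, iSup_iSup_eq_left,
    mem_ofPred_eq, h, EReal.coe_le_coe_iff]
  exact ⟨fun h => le_antisymm h.2 h.1, fun h => ⟨h.ge, h.le⟩⟩

theorem maxS_singleton {E : Type*} {φ : E → ℝ} {X : Set E} {y : E} (hy : y ∈ X)
    (hmax : ∀ x ∈ X, φ x ≤ φ y) : maxS (fun x => {φ x}) X = {x ∈ X | φ x = φ y} := by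
  simp [maxS, maxV_singleton hy hmax, eq_comm (a := φ y)]

/-! ## The way-below relation -/

theorem WayBelow.le {D : Type*} [PartialOrder D] {x y : D} (h : WayBelow x y) : x ≤ y := by
  obtain ⟨d, hd, hx⟩ := h {y} (singleton_nonempty y) (directedOn_singleton y) y
    isLUB_singleton le_rfl
  rwa [mem_singleton_iff.1 hd] at hx

/-- The compactness argument behind both way-below criteria, stated for an abstract carrier map `c`
so that it applies to boxes and to compact sets alike. If all members are the whole space, then so
is `U`. -/
theorem exists_subset_of_directed {D X : Type*} [Preorder D] [TopologicalSpace X]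
    {c : D → Set X} (hc : ∀ {d e}, d ≤ e → c e ⊆ c d)
    (hcpt : ∀ d, c d = univ ∨ IsCompact (c d) ∧ IsClosed (c d)) {S : Set D} (hS : S.Nonempty)
    (hdir : DirectedOn (· ≤ ·) S) {U : Set X} (hU : IsOpen U)
    (h : ∀ x, (∀ d ∈ S, x ∈ c d) → x ∈ U) : ∃ d ∈ S, c d ⊆ U := by
  by_cases hall : ∀ d ∈ S, c d = univ
  · obtain ⟨d, hd⟩ := hS
    exact ⟨d, hd, fun x _ => h x fun e he => by simp [hall e he]⟩
  push Not at hall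
  obtain ⟨d₀, hd₀, hne⟩ := hall
  have h₀ := (hcpt d₀).resolve_left hne
  have hcl : ∀ d, IsClosed (c d) := fun d => by
    rcases hcpt d with h | h
    · rw [h]; exact isClosed_univ
    · exact h.2
  -- The members above the compact `d₀` are cofinal by directedness. They form a directed family of
  -- compact sets with the same intersection.
  let V : {d // d ∈ S ∧ d₀ ≤ d} → Set X := fun d => c d.1
  have : Nonempty {d // d ∈ S ∧ d₀ ≤ d} := ⟨⟨d₀, hd₀, le_rfl⟩⟩
  have hV : Directed (· ⊇ ·) V := by
    rintro ⟨d, hd, hd'⟩ ⟨e, he, -⟩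
    obtain ⟨g, hg, hdg, heg⟩ := hdir d hd e he
    exact ⟨⟨g, hg, hd'.trans hdg⟩, hc hdg, hc heg⟩
  obtain ⟨⟨d, hd, _⟩, hdU⟩ := exists_subset_nhds_of_isCompact' hV
    (fun d => h₀.1.of_isClosed_subset (hcl d.1) (hc d.2.2)) (fun d => hcl d.1)
    (U := U) (fun x hx => hU.mem_nhds (h x fun e he => by
      obtain ⟨g, hg, hdg, heg⟩ := hdir d₀ hd₀ e he
      exact hc heg (mem_iInter.1 hx ⟨g, hg, hdg⟩)))
  exact ⟨d, hd, hdU⟩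

namespace IDom

/-- The least upper bound need not be computed: a point `x` common to all members of `S` gives the
upper bound `{x}`, so `x` lies in `s` and hence in `α`. Compactness then puts one member inside the
interior of `e`. -/
theorem wayBelow_of_subset_interior {E : Type*} [PartialOrder E] [TopologicalSpace E]
    [CompactIccSpace E] [OrderClosedTopology E] {e α : IDom E}
    (h : α.carrier ⊆ interior e.carrier) : WayBelow e α := by
  intro S hS hdir s hs hαs
  obtain ⟨d, hd, hde⟩ := exists_subset_of_directed (c := IDom.carrier) (fun h => h)
    (fun d => d.isBox.imp_right fun ⟨a, b, _, h⟩ => h ▸ ⟨isCompact_Icc, isClosed_Icc⟩) hS hdir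
    isOpen_interior (U := interior e.carrier) fun x hx => h (hαs (by
      have : s ≤ point x := hs.2 fun d hd => singleton_subset_iff.2 (hx d hd)
      exact singleton_subset_iff.1 this))
  exact ⟨d, hd, hde.trans interior_subset⟩

/-- The intervals of radius `1 / (k + 1)` around `m` have supremum `{m}`, so one of them must lie in
`e`. -/
theorem mem_interior_of_wayBelow_point {e : IDom ℝ} {m : ℝ} (h : WayBelow e (point m)) :
    m ∈ interior e.carrier := by
  have hle : ∀ k : ℕ, m - 1 / ((k : ℝ) + 1) ≤ m + 1 / ((k : ℝ) + 1) := fun k => by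
    have : 0 < 1 / ((k : ℝ) + 1) := Nat.one_div_pos_of_nat
    linarith
  let I : ℕ → IDom ℝ := fun k =>
    ⟨Icc (m - 1 / ((k : ℝ) + 1)) (m + 1 / ((k : ℝ) + 1)), Or.inr ⟨_, _, hle k, rfl⟩⟩
  have hmono : Monotone I := fun k l hkl =>
    Icc_subset_Icc (by have := Nat.one_div_le_one_div (α := ℝ) hkl; linarith)
      (by have := Nat.one_div_le_one_div (α := ℝ) hkl; linarith)
  have hlub : IsLUB (range I) (point m) := by
    constructor
    · rintro _ ⟨k, rfl⟩
      have : 0 < 1 / ((k : ℝ) + 1) := Nat.one_div_pos_of_nat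
      exact singleton_subset_iff.2 ⟨by linarith, by linarith⟩
    · intro t ht x hx
      have key : ∀ k : ℕ, |x - m| ≤ 1 / ((k : ℝ) + 1) := fun k => by
        have := ht (mem_range_self k) hx
        rw [abs_le]; exact ⟨by linarith [this.1], by linarith [this.2]⟩
      have : |x - m| ≤ 0 := ge_of_tendsto' tendsto_one_div_add_atTop_nhds_zero_nat key
      exact sub_eq_zero.1 (abs_nonpos_iff.1 this)
  obtain ⟨_, ⟨k, rfl⟩, hk⟩ := h (range I) (range_nonempty I)
    (directedOn_range.2 hmono.directed_le) _ hlub le_rfl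
  have : 0 < 1 / ((k : ℝ) + 1) := Nat.one_div_pos_of_nat
  exact mem_interior_iff_mem_nhds.2
    (Filter.mem_of_superset (Icc_mem_nhds (by linarith) (by linarith)) hk)

theorem subset_hull {E : Type*} [ConditionallyCompleteLattice E] (S : Set E) :
    S ⊆ (hull S).carrier := by
  intro x hx
  rw [hull]
  split_ifs with h
  · exact ⟨csInf_le h.2.1 hx, le_csSup h.2.2 hx⟩
  · trivial

theorem hull_subset_Icc {E : Type*} [ConditionallyCompleteLattice E] {S : Set E} {a b : E}
    (hS : S.Nonempty) (h : S ⊆ Icc a b) : (hull S).carrier ⊆ Icc a b := by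
  rw [hull, dif_pos ⟨hS, ⟨a, fun x hx => (h hx).1⟩, ⟨b, fun x hx => (h hx).2⟩⟩]
  exact Icc_subset_Icc (le_csInf hS fun x hx => (h hx).1) (csSup_le hS fun x hx => (h hx).2)

theorem wayBelow_extend {E F : Type*} [PartialOrder E] [ConditionallyCompleteLattice F]
    [TopologicalSpace F] [CompactIccSpace F] [OrderClosedTopology F] {f : E → F} {d : IDom E}
    {e : IDom F} {a b : F} (hd : d.carrier.Nonempty) (hf : ∀ y ∈ d.carrier, f y ∈ Icc a b)
    (he : Icc a b ⊆ interior e.carrier) : WayBelow e (extend (fun y => point (f y)) d) := by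
  refine wayBelow_of_subset_interior ((hull_subset_Icc ?_ ?_).trans he)
  · obtain ⟨y, hy⟩ := hd
    exact ⟨f y, mem_iUnion₂.2 ⟨y, hy, rfl⟩⟩
  · exact iUnion₂_subset fun y hy => singleton_subset_iff.2 (hf y hy)

/-- Soundness of a fact needs only inclusion of the values, not the full strength of the way-below
relation. -/
theorem mem_of_wayBelow_extend {E F : Type*} [PartialOrder E] [ConditionallyCompleteLattice F]
    {f : E → F} {d : IDom E} {e : IDom F} (h : WayBelow e (extend (fun y => point (f y)) d))
    {y : E} (hy : y ∈ d.carrier) : f y ∈ e.carrier :=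
  h.le (subset_hull _ (mem_iUnion₂.2 ⟨y, hy, rfl⟩))

end IDom

namespace KDom

theorem wayBelow_of_subset_interior {E : Type*} [TopologicalSpace E] [T2Space E] {e K : KDom E}
    (h : K.carrier ⊆ interior e.carrier) : WayBelow e K := by
  intro S hS hdir s hs hαs
  obtain ⟨d, hd, hde⟩ := exists_subset_of_directed (c := KDom.carrier) (fun h => h)
    (fun d => d.isCompactOrBot.imp_right fun h => ⟨h.2, h.2.isClosed⟩) hS hdir
    isOpen_interior (U := interior e.carrier) fun x hx => h (hαs (by
      have : s ≤ ⟨{x}, Or.inr ⟨singleton_nonempty x, isCompact_singleton⟩⟩ :=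
        hs.2 fun d hd => singleton_subset_iff.2 (hx d hd)
      exact singleton_subset_iff.1 this))
  exact ⟨d, hd, hde.trans interior_subset⟩

/-- The closed thickenings of radius `1 / (k + 1)` are compact, since the space is proper, and
decrease to the closed set `K`. One of them lies in `e`, and the open thickening inside it gives the
interior. -/
theorem subset_interior_of_wayBelow {E : Type*} [MetricSpace E] [ProperSpace E] {e K : KDom E}
    (hne : K.carrier.Nonempty) (hK : IsCompact K.carrier) (h : WayBelow e K) :
    K.carrier ⊆ interior e.carrier := by
  have hpos : ∀ k : ℕ, 0 < 1 / ((k : ℝ) + 1) := fun k => Nat.one_div_pos_of_nat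
  let I : ℕ → KDom E := fun k =>
    ⟨Metric.cthickening (1 / ((k : ℝ) + 1)) K.carrier,
      Or.inr ⟨hne.mono (Metric.self_subset_cthickening _), hK.cthickening⟩⟩
  have hmono : Monotone I := fun k l hkl =>
    Metric.cthickening_mono (Nat.one_div_le_one_div hkl) _
  have hlub : IsLUB (range I) K := by
    constructor
    · rintro _ ⟨k, rfl⟩
      exact Metric.self_subset_cthickening _
    · intro t ht x hx
      have key : ∀ k : ℕ, Metric.infDist x K.carrier ≤ 1 / ((k : ℝ) + 1) := fun k =>
        ENNReal.toReal_le_of_le_ofReal (hpos k).le (ht (mem_range_self k) hx)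
      have h0 : Metric.infDist x K.carrier ≤ 0 :=
        ge_of_tendsto' tendsto_one_div_add_atTop_nhds_zero_nat key
      exact (hK.isClosed.mem_iff_infDist_zero hne).2 (le_antisymm h0 Metric.infDist_nonneg)
  obtain ⟨_, ⟨k, rfl⟩, hk⟩ := h (range I) (range_nonempty I)
    (directedOn_range.2 hmono.directed_le) _ hlub le_rfl
  exact (Metric.self_subset_thickening (hpos k) _).trans (interior_maximal
    ((Metric.thickening_subset_cthickening _ _).trans hk) Metric.isOpen_thickening)

end KDom

/-! ## Rational approximations -/

theorem exists_ratVal_eq (q : ℚ) : ∃ c : RatCode, ratVal c = q := by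
  -- The code splits the numerator into positive and negative part and stores the denominator minus
  -- one.
  refine ⟨(q.num.toNat, (-q.num).toNat, q.den - 1), ?_⟩
  have h1 : ((q.num.toNat : ℝ) - ((-q.num).toNat : ℝ)) = q.num := by
    have := Int.toNat_sub_toNat_neg q.num
    exact_mod_cast this
  have h2 : ((q.den - 1 : ℕ) : ℝ) + 1 = q.den := by
    have := q.den_pos
    rw [Nat.cast_sub (by omega)]; simp
  simp only [ratVal]
  rw [h1, h2]
  exact (Rat.cast_def q).symm

theorem exists_ratVal_btwn {s t : ℝ} (h : s < t) : ∃ c : RatCode, s < ratVal c ∧ ratVal c < t := by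
  obtain ⟨q, h1, h2⟩ := exists_rat_btwn h
  obtain ⟨c, hc⟩ := exists_ratVal_eq q
  exact ⟨c, hc ▸ h1, hc ▸ h2⟩

/-- Codes of rational boxes of any dimension (two opposite corners). -/
abbrev BoxPair := List RatCode × List RatCode

local instance : Primcodable BoxPair := inferInstance

/-- The `j`-th side of a rational box. -/
def side (b : BoxPair) (j : ℕ) : RatCode × RatCode := (b.1.getD j (0, 0, 0), b.2.getD j (0, 0, 0))

/-- The interval with a given code contains `x`. -/
def InI (I : RatCode × RatCode) (x : ℝ) : Prop := x ∈ uIcc (ratVal I.1) (ratVal I.2)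

/-- The number `x` lies strictly between the end points with the given codes. -/
def Btw (I : RatCode × RatCode) (x : ℝ) : Prop := ratVal I.1 < x ∧ x < ratVal I.2

/-- Both end points of the interval are closer than `δ` to `x`. -/
def Near (δ : ℝ) (I : RatCode × RatCode) (x : ℝ) : Prop :=
  |ratVal I.1 - x| < δ ∧ |ratVal I.2 - x| < δ

theorem Btw.inI {I : RatCode × RatCode} {x : ℝ} (h : Btw I x) : InI I x :=
  Icc_subset_uIcc ⟨h.1.le, h.2.le⟩

theorem InI.abs_sub_lt {I : RatCode × RatCode} {x y δ : ℝ} (hy : InI I y) (h : Near δ I x) :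
    |y - x| < δ := by
  obtain ⟨h1, h2⟩ := h
  rw [abs_lt] at *
  rcases mem_uIcc.1 hy with h | h <;> constructor <;> linarith [h.1, h.2]

/-- The end points are picked in `(x - ε, x - ε/2)` and `(x + ε/2, x + ε)`. The margin `ε/2` leaves
room for a closed interval of radius `ε/2` inside the open interval between them. -/
theorem exists_near_btw (x : ℝ) {ε : ℝ} (hε : 0 < ε) :
    ∃ I, Near ε I x ∧ Btw I x ∧ ratVal I.1 < x - ε / 2 ∧ x + ε / 2 < ratVal I.2 := by
  obtain ⟨p, hp1, hp2⟩ := exists_ratVal_btwn (show x - ε < x - ε / 2 by linarith)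
  obtain ⟨q, hq1, hq2⟩ := exists_ratVal_btwn (show x + ε / 2 < x + ε by linarith)
  refine ⟨(p, q), ⟨?_, ?_⟩, ⟨by simp; linarith, by simp; linarith⟩, hp2, hq1⟩ <;>
    rw [abs_lt] <;> constructor <;> simp <;> linarith

theorem exists_side_eq (n : ℕ) (f : ℕ → RatCode × RatCode) :
    ∃ b : BoxPair, ∀ j < n, side b j = f j := by
  refine ⟨((List.range n).map fun j => (f j).1, (List.range n).map fun j => (f j).2), ?_⟩
  intro j hj
  simp [side, List.getD, hj]

theorem exists_box (n : ℕ) {P : Fin n → RatCode × RatCode → Prop} (h : ∀ j, ∃ I, P j I) :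
    ∃ b : BoxPair, ∀ j : Fin n, P j (side b j) := by
  choose f hf using h
  obtain ⟨b, hb⟩ := exists_side_eq n fun j => if hj : j < n then f ⟨j, hj⟩ else ((0, 0, 0), (0, 0, 0))
  refine ⟨b, fun j => ?_⟩
  rw [hb j j.2]
  simpa using hf j

/-- Matrix codes list entries row by row, so the position `t` is decoded into its row `t / m` and
its column `t % m`. -/
theorem exists_matBox (k m : ℕ) {P : Fin k → Fin m → RatCode × RatCode → Prop}
    (h : ∀ i j, ∃ I, P i j I) :
    ∃ b : BoxPair, ∀ (i : Fin k) (j : Fin m), P i j (side b (i * m + j)) := by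
  choose f hf using h
  obtain ⟨b, hb⟩ := exists_side_eq (k * m) fun t =>
    if ht : t / m < k ∧ t % m < m then f ⟨t / m, ht.1⟩ ⟨t % m, ht.2⟩ else ((0, 0, 0), (0, 0, 0))
  refine ⟨b, fun i j => ?_⟩
  have hj := j.2
  have h1 : ((i : ℕ) * m + j) / m = i := by
    rw [Nat.add_comm, Nat.add_mul_div_right _ _ (by omega), Nat.div_eq_of_lt hj, Nat.zero_add]
  have h2 : ((i : ℕ) * m + j) % m = j := by
    rw [Nat.add_comm, Nat.add_mul_mod_self_right, Nat.mod_eq_of_lt hj]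
  have h3 : (i : ℕ) * m + j < k * m := by
    have := Nat.mul_le_mul_right m (Nat.succ_le_of_lt i.2)
    rw [Nat.succ_mul] at this
    omega
  rw [hb _ h3]
  simp only [h1, h2, i.2, j.2, and_self, dif_pos]
  exact hf i j

theorem mem_uIcc_pi {ι : Type*} {α : ι → Type*} [∀ i, Lattice (α i)] {a b x : ∀ i, α i} :
    x ∈ uIcc a b ↔ ∀ i, x i ∈ uIcc (a i) (b i) := by
  simp only [uIcc, mem_Icc, Pi.le_def, Pi.inf_apply, Pi.sup_apply, forall_and]

theorem mem_boxVal_vec {n : ℕ} {b : BoxPair} {x : Fin n → ℝ} :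
    x ∈ (boxVal (vecVal n) (some b)).carrier ↔ ∀ j : Fin n, InI (side b j) (x j) :=
  mem_uIcc_pi

theorem mem_boxVal_mat {k m : ℕ} {b : BoxPair} {x : Fin k → Fin m → ℝ} :
    x ∈ (boxVal (matVal k m) (some b)).carrier ↔
      ∀ (i : Fin k) (j : Fin m), InI (side b (i * m + j)) (x i j) := by
  refine mem_uIcc_pi.trans (forall_congr' fun i => mem_uIcc_pi)

theorem mem_interior_boxVal_vec {n : ℕ} {b : BoxPair} {x : Fin n → ℝ}
    (h : ∀ j : Fin n, Btw (side b j) (x j)) : x ∈ interior (boxVal (vecVal n) (some b)).carrier := by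
  have ho : IsOpen {y : Fin n → ℝ | ∀ j : Fin n, Btw (side b j) (y j)} := by
    simp only [Btw, ofPred_forall]
    exact isOpen_iInter_of_finite fun j => (isOpen_lt continuous_const (continuous_apply j)).inter
      (isOpen_lt (continuous_apply j) continuous_const)
  exact interior_maximal (fun y hy => mem_boxVal_vec.2 fun j => (hy j).inI) ho h

theorem mem_interior_boxVal_mat {k m : ℕ} {b : BoxPair} {x : Fin k → Fin m → ℝ}
    (h : ∀ (i : Fin k) (j : Fin m), Btw (side b (i * m + j)) (x i j)) :
    x ∈ interior (boxVal (matVal k m) (some b)).carrier := by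
  have ho : IsOpen {y : Fin k → Fin m → ℝ |
      ∀ (i : Fin k) (j : Fin m), Btw (side b (i * m + j)) (y i j)} := by
    simp only [Btw, ofPred_forall]
    exact isOpen_iInter_of_finite fun i => isOpen_iInter_of_finite fun j =>
      (isOpen_lt continuous_const (continuous_apply_apply i j)).inter
      (isOpen_lt (continuous_apply_apply i j) continuous_const)
  exact interior_maximal (fun y hy => mem_boxVal_mat.2 fun i j => (hy i j).inI) ho h

/-! ## Facts about a network -/

namespace Network

variable {H : ℕ} {w : ℕ → ℕ} {N : Network H w}

theorem inI_of_wayBelow {I : RatCode × RatCode} {x : ℝ}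
    (h : WayBelow (boxVal ratVal (some I)) (IDom.point x)) : InI I x :=
  singleton_subset_iff.1 h.le

theorem wayBelow_of_btw {I : RatCode × RatCode} {x : ℝ} (h : Btw I x) :
    WayBelow (boxVal ratVal (some I)) (IDom.point x) :=
  IDom.wayBelow_of_subset_interior (singleton_subset_iff.2
    (interior_maximal (Ioo_subset_Icc_self.trans Icc_subset_uIcc) isOpen_Ioo ⟨h.1, h.2⟩))

/-- Completeness of the data near `y`. By continuity of the activation and of its Jacobian, a small
box `d` around `y` is mapped within `ε/2` of the values at `y`, and `e` and `g` contain that range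
in their interiors. One `d` serves both facts. -/
theorem exists_activation_facts (hN : N.IsDifferentiable) (i : Fin H) (y : Fin (w (i + 1)) → ℝ)
    {ε : ℝ} (hε : 0 < ε) : ∃ d e g : BoxPair,
      (∀ r : Fin (w (i + 1)), Btw (side d r) (y r)) ∧
      (∀ r : Fin (w (i + 1)), Near ε (side e r) (N.σ i y r)) ∧
      (∀ r j : Fin (w (i + 1)), Near ε (side g (r * w (i + 1) + j)) (jacMat (N.σ i) y r j)) ∧
      .inr (.inr (.inr (.inl ((i : ℕ), some d, some e)))) ∈ N.info ∧
      .inr (.inr (.inr (.inr ((i : ℕ), some d, some g)))) ∈ N.info := by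
  obtain ⟨e, he⟩ := exists_box _ fun r => exists_near_btw (N.σ i y r) hε
  obtain ⟨g, hg⟩ := exists_matBox _ _ fun r j => exists_near_btw (jacMat (N.σ i) y r j) hε
  obtain ⟨δ, hδ, h1⟩ := Metric.continuousAt_iff.1 (hN i).continuous.continuousAt (ε / 2) (half_pos hε)
  obtain ⟨θ, hθ, h2⟩ := Metric.continuousAt_iff.1 (continuous_jacMat (hN i)).continuousAt
    (ε / 2) (half_pos hε)
  obtain ⟨d, hd⟩ := exists_box _ fun r => exists_near_btw (y r) (lt_min hδ hθ)
  have hball : ∀ z ∈ (boxVal (vecVal (w (i + 1))) (some d)).carrier, dist z y < min δ θ := by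
    intro z hz
    rw [mem_boxVal_vec] at hz
    exact (dist_pi_lt_iff (lt_min hδ hθ)).2 fun r => (hz r).abs_sub_lt (hd r).1
  have hne : (boxVal (vecVal (w (i + 1))) (some d)).carrier.Nonempty :=
    ⟨y, mem_boxVal_vec.2 fun r => (hd r).2.1.inI⟩
  refine ⟨d, e, g, fun r => (hd r).2.1, fun r => (he r).1, fun r j => (hg r j).1, ⟨i.2, ?_⟩,
    ⟨i.2, ?_⟩⟩
  · refine IDom.wayBelow_extend (a := fun r => N.σ i y r - ε / 2)
      (b := fun r => N.σ i y r + ε / 2) hne (fun z hz => ?_) (fun v hv => ?_)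
    · have h := h1 ((hball z hz).trans_le (min_le_left _ _))
      have h' := fun r => abs_lt.1 (lt_of_le_of_lt (dist_le_pi_dist (N.σ i z) (N.σ i y) r) h)
      exact ⟨fun r => by linarith [(h' r).1], fun r => by linarith [(h' r).2]⟩
    · exact mem_interior_boxVal_vec fun r =>
        ⟨(he r).2.2.1.trans_le (hv.1 r), (hv.2 r).trans_lt (he r).2.2.2⟩
  · rw [LhatVec_eq_point (hN _)]
    refine IDom.wayBelow_extend (a := fun r j => jacMat (N.σ i) y r j - ε / 2)
      (b := fun r j => jacMat (N.σ i) y r j + ε / 2) hne (fun z hz => ?_) (fun v hv => ?_)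
    · have h := h2 ((hball z hz).trans_le (min_le_right _ _))
      have h' := fun r j => abs_lt.1
        (lt_of_le_of_lt ((dist_le_pi_dist (jacMat (N.σ i) z r) (jacMat (N.σ i) y r) j).trans
          (dist_le_pi_dist _ _ r)) h)
      exact ⟨fun r j => by linarith [(h' r j).1], fun r j => by linarith [(h' r j).2]⟩
    · exact mem_interior_boxVal_mat fun r j =>
        ⟨(hg r j).2.2.1.trans_le (hv.1 r j), (hv.2 r j).trans_lt (hg r j).2.2.2⟩

theorem inI_activation {i : ℕ} {hi : i < H} {d e : BoxPair}
    (h : .inr (.inr (.inr (.inl (i, some d, some e)))) ∈ N.info) {y : Fin (w (i + 1)) → ℝ}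
    (hy : ∀ r : Fin (w (i + 1)), InI (side d r) (y r)) (r : Fin (w (i + 1))) :
    InI (side e r) (N.σ ⟨i, hi⟩ y r) := by
  obtain ⟨_, h⟩ := h
  exact mem_boxVal_vec.1 (IDom.mem_of_wayBelow_extend h (mem_boxVal_vec.2 hy)) r

theorem inI_derivative (hN : N.IsDifferentiable) {i : ℕ} {hi : i < H} {d g : BoxPair}
    (h : .inr (.inr (.inr (.inr (i, some d, some g)))) ∈ N.info) {y : Fin (w (i + 1)) → ℝ}
    (hy : ∀ r : Fin (w (i + 1)), InI (side d r) (y r)) (r j : Fin (w (i + 1))) :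
    InI (side g (r * w (i + 1) + j)) (jacMat (N.σ ⟨i, hi⟩) y r j) := by
  obtain ⟨_, h⟩ := h
  rw [LhatVec_eq_point (hN _)] at h
  exact mem_boxVal_mat.1 (IDom.mem_of_wayBelow_extend h (mem_boxVal_vec.2 hy)) r j

end Network

/-! ## Primitive recursive predicates -/

attribute [fun_prop] Primrec
attribute [fun_prop] Primrec.id Primrec.const Primrec.comp Primrec.pair

section

variable {α β γ : Type*} [Primcodable α] [Primcodable β] [Primcodable γ]

@[fun_prop]
theorem primrec_fst {f : α → β × γ} (hf : Primrec f) : Primrec fun a => (f a).1 :=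
  Primrec.fst.comp hf

@[fun_prop]
theorem primrec_snd {f : α → β × γ} (hf : Primrec f) : Primrec fun a => (f a).2 :=
  Primrec.snd.comp hf

@[fun_prop]
theorem primrec_add {f g : α → ℕ} (hf : Primrec f) (hg : Primrec g) :
    Primrec fun a => f a + g a :=
  Primrec.nat_add.comp hf hg

@[fun_prop]
theorem primrec_sub {f g : α → ℕ} (hf : Primrec f) (hg : Primrec g) :
    Primrec fun a => f a - g a :=
  Primrec.nat_sub.comp hf hg

@[fun_prop]
theorem primrec_mul {f g : α → ℕ} (hf : Primrec f) (hg : Primrec g) :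
    Primrec fun a => f a * g a :=
  Primrec.nat_mul.comp hf hg

@[fun_prop]
theorem primrec_div {f g : α → ℕ} (hf : Primrec f) (hg : Primrec g) :
    Primrec fun a => f a / g a :=
  Primrec.nat_div.comp hf hg

@[fun_prop]
theorem primrec_mod {f g : α → ℕ} (hf : Primrec f) (hg : Primrec g) :
    Primrec fun a => f a % g a :=
  Primrec.nat_mod.comp hf hg

@[fun_prop]
theorem primrec_pow {f g : α → ℕ} (hf : Primrec f) (hg : Primrec g) :
    Primrec fun a => f a ^ g a := by
  refine (Primrec.nat_rec' (h := fun a p => p.2 * f a) hg (Primrec.const 1) ?_).of_eq fun a => ?_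
  · unfold Primrec₂
    fun_prop
  · induction g a with
    | zero => rfl
    | succ k ih => rw [pow_succ, ← ih]

@[fun_prop]
theorem primrec_getD {f : α → List β} {g : α → ℕ} {d : β} (hf : Primrec f) (hg : Primrec g) :
    Primrec fun a => (f a).getD (g a) d :=
  (Primrec.list_getD d).comp hf hg

@[fun_prop]
theorem primrec_cons {f : α → β} {g : α → List β} (hf : Primrec f) (hg : Primrec g) :
    Primrec fun a => f a :: g a :=
  Primrec.list_cons.comp hf hg

@[fun_prop]
theorem primrec_append {f g : α → List β} (hf : Primrec f) (hg : Primrec g) :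
    Primrec fun a => f a ++ g a :=
  Primrec.list_append.comp hf hg

@[fun_prop]
theorem primrec_length {f : α → List β} (hf : Primrec f) : Primrec fun a => (f a).length :=
  Primrec.list_length.comp hf

@[fun_prop]
theorem primrec_some {f : α → β} (hf : Primrec f) : Primrec fun a => some (f a) :=
  Primrec.option_some.comp hf

@[fun_prop]
theorem primrec_inl {f : α → β} (hf : Primrec f) : Primrec fun a => (Sum.inl (f a) : β ⊕ γ) :=
  Primrec.sumInl.comp hf

@[fun_prop]
theorem primrec_inr {f : α → γ} (hf : Primrec f) : Primrec fun a => (Sum.inr (f a) : β ⊕ γ) :=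
  Primrec.sumInr.comp hf

@[fun_prop]
theorem primrec_option_getD {f : α → Option β} {d : β} (hf : Primrec f) :
    Primrec fun a => (f a).getD d :=
  Primrec.option_getD.comp hf (Primrec.const d)

theorem primrecPred_eq {f g : α → β} (hf : Primrec f) (hg : Primrec g) :
    PrimrecPred fun a => f a = g a :=
  Primrec.eq.comp hf hg

theorem primrecPred_natLt {f g : α → ℕ} (hf : Primrec f) (hg : Primrec g) :
    PrimrecPred fun a => f a < g a :=
  Primrec.nat_lt.comp hf hg

theorem primrecPred_forall_mem {f : α → List β} {p : α → β → Prop} (hf : Primrec f)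
    (hp : PrimrecPred fun q : α × β => p q.1 q.2) : PrimrecPred fun a => ∀ x ∈ f a, p a x :=
  (PrimrecRel.forall_mem_list (R := fun x a => p a x)
    (PrimrecPred.comp hp (Primrec.pair Primrec.snd Primrec.fst))).comp hf Primrec.id

theorem primrecPred_exists_mem {f : α → List β} {p : α → β → Prop} (hf : Primrec f)
    (hp : PrimrecPred fun q : α × β => p q.1 q.2) : PrimrecPred fun a => ∃ x ∈ f a, p a x :=
  (PrimrecRel.exists_mem_list (R := fun x a => p a x)
    (PrimrecPred.comp hp (Primrec.pair Primrec.snd Primrec.fst))).comp hf Primrec.id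

theorem primrecPred_forall_lt {f : α → ℕ} {p : α → ℕ → Prop} (hf : Primrec f)
    (hp : PrimrecPred fun q : α × ℕ => p q.1 q.2) : PrimrecPred fun a => ∀ k < f a, p a k :=
  (primrecPred_forall_mem (Primrec.list_range.comp hf) hp).of_eq fun a => by simp

theorem primrecPred_exists_lt {f : α → ℕ} {p : α → ℕ → Prop} (hf : Primrec f)
    (hp : PrimrecPred fun q : α × ℕ => p q.1 q.2) : PrimrecPred fun a => ∃ k < f a, p a k :=
  (primrecPred_exists_mem (Primrec.list_range.comp hf) hp).of_eq fun a => by simp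

/-- The list appears as the set of its members because the checks are written for an arbitrary set
of facts and are run on finite ones. -/
theorem primrecPred_mem {f : α → β} {l : α → List β} (hf : Primrec f) (hl : Primrec l) :
    PrimrecPred fun a => f a ∈ {x | x ∈ l a} :=
  (primrecPred_exists_mem (p := fun a x => f a = x) hl
    (primrecPred_eq (by fun_prop) (by fun_prop))).of_eq fun a => by simp

/-- A projection of a primitive recursive predicate is recursively enumerable. -/
theorem REPred.of_exists_primrec {p : α → β → Prop} (hp : PrimrecPred fun q : α × β => p q.1 q.2) :
    REPred fun a => ∃ b, p a b := by
  classical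
  have hd : Primrec fun q : α × β => decide (p q.1 q.2) :=
    hp.decide
  -- The semi-decision procedure searches through the natural numbers, decodes each as a possible
  -- witness and tests it.
  let f : α → ℕ → Option Unit := fun a n =>
    (Encodable.decode (α := β) n).bind fun b => bif decide (p a b) then some () else none
  have hf : Primrec₂ f := by
    refine Primrec.option_bind (Primrec.decode.comp Primrec.snd) ?_
    refine Primrec.cond (c := fun x : (α × ℕ) × β => decide (p x.1.1 x.2)) ?_
      (Primrec.const _) (Primrec.const _)
    exact hd.comp (f := fun q : α × β => decide (p q.1 q.2))
      (g := fun x : (α × ℕ) × β => (x.1.1, x.2)) (by fun_prop)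
  have hpart := Partrec.rfindOpt (Primrec₂.to_comp hf)
  refine hpart.of_eq fun a => Part.ext' ?_ fun _ _ => rfl
  rw [Nat.rfindOpt_dom]
  constructor
  · rintro ⟨n, _, h⟩
    obtain ⟨b, -, hb⟩ := Option.bind_eq_some_iff.1 h
    refine ⟨⟨b, ?_⟩, trivial⟩
    by_contra hne
    simp [hne] at hb
  · rintro ⟨⟨b, hb⟩, -⟩
    exact ⟨Encodable.encode b, (), by simp [f, hb]⟩

end

/-! ## Arithmetic of codes of rational numbers -/

/-- Sum of codes. -/
def addC (p q : RatCode) : RatCode :=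
  (p.1 * (q.2.2 + 1) + q.1 * (p.2.2 + 1), p.2.1 * (q.2.2 + 1) + q.2.1 * (p.2.2 + 1),
    p.2.2 * q.2.2 + p.2.2 + q.2.2)

/-- Product of codes. -/
def mulC (p q : RatCode) : RatCode :=
  (p.1 * q.1 + p.2.1 * q.2.1, p.1 * q.2.1 + p.2.1 * q.1, p.2.2 * q.2.2 + p.2.2 + q.2.2)

/-- Difference of codes. -/
def subC (p q : RatCode) : RatCode := addC p (q.2.1, q.1, q.2.2)

/-- Absolute value of a code. -/
def absC (p : RatCode) : RatCode := (p.1 - p.2.1 + (p.2.1 - p.1), 0, p.2.2)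

/-- Sum of the first `n` terms of a sequence of codes. -/
def sumC : ℕ → (ℕ → RatCode) → RatCode
  | 0, _ => (0, 0, 0)
  | n + 1, f => addC (sumC n f) (f n)

@[simp]
theorem ratVal_zero : ratVal (0, 0, 0) = 0 := by simp [ratVal]

@[simp]
theorem ratVal_one : ratVal (1, 0, 0) = 1 := by simp [ratVal]

@[simp]
theorem ratVal_addC (p q : RatCode) : ratVal (addC p q) = ratVal p + ratVal q := by
  have hp : (p.2.2 : ℝ) + 1 ≠ 0 := by positivity
  have hq : (q.2.2 : ℝ) + 1 ≠ 0 := by positivity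
  -- Codes store the denominator minus one, and `(a + 1) * (b + 1) - 1 = a * b + a + b`.
  have h : ((p.2.2 * q.2.2 + p.2.2 + q.2.2 : ℕ) : ℝ) + 1 = (p.2.2 + 1) * (q.2.2 + 1) := by
    push_cast; ring
  simp only [ratVal, addC, h]
  push_cast
  field_simp
  ring

@[simp]
theorem ratVal_mulC (p q : RatCode) : ratVal (mulC p q) = ratVal p * ratVal q := by
  have h : ((p.2.2 * q.2.2 + p.2.2 + q.2.2 : ℕ) : ℝ) + 1 = (p.2.2 + 1) * (q.2.2 + 1) := by
    push_cast; ring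
  simp only [ratVal, mulC, h, div_mul_div_comm]
  push_cast
  ring

@[simp]
theorem ratVal_subC (p q : RatCode) : ratVal (subC p q) = ratVal p - ratVal q := by
  rw [subC, ratVal_addC]
  simp only [ratVal]
  ring

@[simp]
theorem ratVal_absC (p : RatCode) : ratVal (absC p) = |ratVal p| := by
  have hp : (0 : ℝ) < (p.2.2 : ℝ) + 1 := by positivity
  simp only [ratVal, absC, abs_div, abs_of_pos hp]
  congr 1
  -- Subtraction is truncated, so one of the two differences in `absC` vanishes and the other is the
  -- absolute value.
  rcases le_total p.1 p.2.1 with h | h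
  · rw [Nat.sub_eq_zero_of_le h, abs_of_nonpos (by simpa using h)]
    push_cast [h]; ring
  · rw [Nat.sub_eq_zero_of_le h, abs_of_nonneg (by simpa using h)]
    push_cast [h]; ring

@[simp]
theorem ratVal_sumC (n : ℕ) (f : ℕ → RatCode) :
    ratVal (sumC n f) = ∑ k : Fin n, ratVal (f k) := by
  induction n with
  | zero => simp [sumC]
  | succ n ih => simp [sumC, ih, Fin.sum_univ_castSucc]

/-- Cross-multiplication with the negative terms moved to the other side keeps the comparison within
the natural numbers, where it is primitive recursive. -/
theorem ratVal_lt_iff (p q : RatCode) : ratVal p < ratVal q ↔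
    p.1 * (q.2.2 + 1) + q.2.1 * (p.2.2 + 1) < q.1 * (p.2.2 + 1) + p.2.1 * (q.2.2 + 1) := by
  have hp : (0 : ℝ) < (p.2.2 : ℝ) + 1 := by positivity
  have hq : (0 : ℝ) < (q.2.2 : ℝ) + 1 := by positivity
  rw [ratVal, ratVal, div_lt_div_iff₀ hp hq, ← Nat.cast_lt (α := ℝ)]
  push_cast
  constructor <;> intro h <;> linarith

section

variable {α : Type*} [Primcodable α]

@[fun_prop]
theorem primrec_addC {f g : α → RatCode} (hf : Primrec f) (hg : Primrec g) :
    Primrec fun a => addC (f a) (g a) := by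
  unfold addC; fun_prop

@[fun_prop]
theorem primrec_mulC {f g : α → RatCode} (hf : Primrec f) (hg : Primrec g) :
    Primrec fun a => mulC (f a) (g a) := by
  unfold mulC; fun_prop

@[fun_prop]
theorem primrec_subC {f g : α → RatCode} (hf : Primrec f) (hg : Primrec g) :
    Primrec fun a => subC (f a) (g a) := by
  unfold subC; fun_prop

@[fun_prop]
theorem primrec_absC {f : α → RatCode} (hf : Primrec f) : Primrec fun a => absC (f a) := by
  unfold absC; fun_prop

theorem primrec_sumC {m : α → ℕ} {f : α → ℕ → RatCode} (hm : Primrec m)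
    (hf : Primrec fun p : α × ℕ => f p.1 p.2) : Primrec fun a => sumC (m a) (f a) := by
  refine (Primrec.nat_rec' (h := fun a p => addC p.2 (f a p.1)) hm
    (Primrec.const (0, 0, 0)) ?_).of_eq fun a => ?_
  · have : Primrec fun x : α × ℕ × RatCode => f x.1 x.2.1 :=
      hf.comp (f := fun p : α × ℕ => f p.1 p.2)
        (g := fun x : α × ℕ × RatCode => (x.1, x.2.1)) (by fun_prop)
    unfold Primrec₂
    fun_prop
  · induction m a with
    | zero => rfl
    | succ k ih => exact congrArg (fun s => addC s (f a k)) ih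

theorem primrecPred_lt {f g : α → RatCode} (hf : Primrec f) (hg : Primrec g) :
    PrimrecPred fun a => ratVal (f a) < ratVal (g a) :=
  (primrecPred_natLt (f := fun a => (f a).1 * ((g a).2.2 + 1) + (g a).2.1 * ((f a).2.2 + 1))
    (g := fun a => (g a).1 * ((f a).2.2 + 1) + (f a).2.1 * ((g a).2.2 + 1))
    (by fun_prop) (by fun_prop)).of_eq fun a => (ratVal_lt_iff _ _).symm

theorem primrecPred_le {f g : α → RatCode} (hf : Primrec f) (hg : Primrec g) :
    PrimrecPred fun a => ratVal (f a) ≤ ratVal (g a) :=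
  (primrecPred_lt hg hf).not.of_eq fun _ => not_lt

@[fun_prop]
theorem primrec_side {f : α → BoxPair} {g : α → ℕ} (hf : Primrec f) (hg : Primrec g) :
    Primrec fun a => side (f a) (g a) := by
  unfold side; fun_prop

end

/-! ## Interval evaluation of inner products -/

/-- The code of a bound for the deviation of a product of two numbers from given intervals from the
product of the first end points. -/
def errC (a b : RatCode × RatCode) : RatCode :=
  addC (addC (mulC (absC a.1) (absC (subC b.2 b.1))) (mulC (absC b.1) (absC (subC a.2 a.1))))
    (mulC (absC (subC a.2 a.1)) (absC (subC b.2 b.1)))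

/-- The value of `c + ∑ k < m, A k * B k` at the first end points. -/
def ctrC (m : ℕ) (A B : ℕ → RatCode × RatCode) (c : RatCode × RatCode) : RatCode :=
  addC c.1 (sumC m fun k => mulC (A k).1 (B k).1)

/-- A bound for the deviation of `c + ∑ k < m, A k * B k` from its value at the first end points. -/
def radC (m : ℕ) (A B : ℕ → RatCode × RatCode) (c : RatCode × RatCode) : RatCode :=
  addC (absC (subC c.2 c.1)) (sumC m fun k => errC (A k) (B k))

/-- Interval evaluation shows that `c + ∑ k < m, A k * B k` lies in the interval `t`. -/
def Encloses (m : ℕ) (A B : ℕ → RatCode × RatCode) (c t : RatCode × RatCode) : Prop :=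
  ratVal t.1 ≤ ratVal (subC (ctrC m A B c) (radC m A B c)) ∧
    ratVal (addC (ctrC m A B c) (radC m A B c)) ≤ ratVal t.2

theorem primrecPred_encloses {α : Type*} [Primcodable α] {m : α → ℕ}
    {A B : α → ℕ → RatCode × RatCode} {c t : α → RatCode × RatCode} (hm : Primrec m)
    (hA : Primrec fun p : α × ℕ => A p.1 p.2) (hB : Primrec fun p : α × ℕ => B p.1 p.2)
    (hc : Primrec c) (ht : Primrec t) :
    PrimrecPred fun a => Encloses (m a) (A a) (B a) (c a) (t a) := by
  have h1 : Primrec fun a => ctrC (m a) (A a) (B a) (c a) := by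
    unfold ctrC
    have := primrec_sumC (f := fun a k => mulC (A a k).1 (B a k).1) hm (by fun_prop)
    fun_prop
  have h2 : Primrec fun a => radC (m a) (A a) (B a) (c a) := by
    unfold radC
    have := primrec_sumC (f := fun a k => errC (A a k) (B a k)) hm (by unfold errC; fun_prop)
    fun_prop
  unfold Encloses
  exact (primrecPred_le (by fun_prop) (by fun_prop)).and
    (primrecPred_le (by fun_prop) (by fun_prop))

theorem abs_mul_sub_mul_le (a b x y : ℝ) :
    |x * y - a * b| ≤ |a| * |y - b| + |b| * |x - a| + |x - a| * |y - b| := by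
  have h : x * y - a * b = a * (y - b) + b * (x - a) + (x - a) * (y - b) := by ring
  rw [h]
  refine (abs_add_three _ _ _).trans (le_of_eq ?_)
  simp only [abs_mul]

/-- The first end point acts as a centre and the distance of the end points as a radius. This avoids
case distinctions by sign and by the order of the end points, at the price of a coarser bound that
still tends to `0`. -/
theorem InI.abs_mul_sub_le {a b : RatCode × RatCode} {x y : ℝ} (hx : InI a x) (hy : InI b y) :
    |x * y - ratVal a.1 * ratVal b.1| ≤ ratVal (errC a b) := by
  have h1 := abs_sub_left_of_mem_uIcc hx
  have h2 := abs_sub_left_of_mem_uIcc hy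
  refine (abs_mul_sub_mul_le _ _ _ _).trans ?_
  simp only [errC, ratVal_addC, ratVal_mulC, ratVal_absC, ratVal_subC]
  gcongr

theorem Encloses.inI {m : ℕ} {A B : ℕ → RatCode × RatCode} {c t : RatCode × RatCode}
    (h : Encloses m A B c t) {x y : Fin m → ℝ} {z : ℝ} (hx : ∀ k : Fin m, InI (A k) (x k))
    (hy : ∀ k : Fin m, InI (B k) (y k)) (hz : InI c z) : InI t (∑ k, x k * y k + z) := by
  have h1 : |∑ k, x k * y k + z - ratVal (ctrC m A B c)| ≤ ratVal (radC m A B c) := by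
    simp only [ctrC, radC, ratVal_addC, ratVal_sumC, ratVal_mulC, ratVal_absC, ratVal_subC]
    have e : ∑ k, x k * y k + z - (ratVal c.1 + ∑ k : Fin m, ratVal (A k).1 * ratVal (B k).1) =
        (z - ratVal c.1) + ∑ k : Fin m, (x k * y k - ratVal (A k).1 * ratVal (B k).1) := by
      rw [Finset.sum_sub_distrib]; ring
    rw [e]
    refine (abs_add_le _ _).trans (add_le_add (abs_sub_left_of_mem_uIcc hz) ?_)
    exact (Finset.abs_sum_le_sum_abs _ _).trans
      (Finset.sum_le_sum fun k _ => (hx k).abs_mul_sub_le (hy k))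
  rw [Encloses, ratVal_subC, ratVal_addC] at h
  rw [abs_le] at h1
  exact Icc_subset_uIcc ⟨by linarith, by linarith⟩

/-- Converse of `Encloses.inI` for narrow intervals. Centre and radius depend continuously on the
end points; when all end points equal the true values, the radius is `0` and the centre is the exact
value, which lies strictly inside `t`. The form "for all small `δ`" allows finitely many such
conditions to be met at once. -/
theorem eventually_encloses {m : ℕ} (x y : Fin m → ℝ) (z : ℝ) {t : RatCode × RatCode}
    (ht : Btw t (∑ k, x k * y k + z)) :
    ∀ᶠ δ in 𝓝[>] (0 : ℝ), ∀ (A B : ℕ → RatCode × RatCode) (c : RatCode × RatCode),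
      (∀ k : Fin m, Near δ (A k) (x k)) → (∀ k : Fin m, Near δ (B k) (y k)) → Near δ c z →
        Encloses m A B c t := by
  let ctr : ((Fin m → ℝ) × (Fin m → ℝ)) × ((Fin m → ℝ) × (Fin m → ℝ)) × (ℝ × ℝ) → ℝ := fun p =>
    p.2.2.1 + ∑ k, p.1.1 k * p.2.1.1 k
  let rad : ((Fin m → ℝ) × (Fin m → ℝ)) × ((Fin m → ℝ) × (Fin m → ℝ)) × (ℝ × ℝ) → ℝ := fun p =>
    |p.2.2.2 - p.2.2.1| + ∑ k, (|p.1.1 k| * |p.2.1.2 k - p.2.1.1 k| +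
      |p.2.1.1 k| * |p.1.2 k - p.1.1 k| + |p.1.2 k - p.1.1 k| * |p.2.1.2 k - p.2.1.1 k|)
  have h1 : Continuous fun p => ctr p - rad p := by fun_prop
  have h2 : Continuous fun p => ctr p + rad p := by fun_prop
  have e1 : ctr ((x, x), (y, y), (z, z)) = ∑ k, x k * y k + z := by simp [ctr, add_comm]
  have e2 : rad ((x, x), (y, y), (z, z)) = 0 := by simp [rad]
  have hev : ∀ᶠ p in 𝓝 ((x, x), (y, y), (z, z)),
      ratVal t.1 < ctr p - rad p ∧ ctr p + rad p < ratVal t.2 := by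
    refine (h1.continuousAt.eventually (lt_mem_nhds ?_)).and
      (h2.continuousAt.eventually (gt_mem_nhds ?_))
    · beta_reduce; rw [e1, e2, sub_zero]; exact ht.1
    · beta_reduce; rw [e1, e2, add_zero]; exact ht.2
  obtain ⟨δ₀, hδ₀, hball⟩ := Metric.eventually_nhds_iff.1 hev
  filter_upwards [Ioo_mem_nhdsGT hδ₀] with δ hδ A B c hA hB hc
  have hd : dist (((fun k : Fin m => ratVal (A k).1, fun k : Fin m => ratVal (A k).2),
      (fun k : Fin m => ratVal (B k).1, fun k : Fin m => ratVal (B k).2),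
      (ratVal c.1, ratVal c.2)) :
      ((Fin m → ℝ) × (Fin m → ℝ)) × ((Fin m → ℝ) × (Fin m → ℝ)) × (ℝ × ℝ))
      ((x, x), (y, y), (z, z)) < δ₀ := by
    refine lt_of_le_of_lt ?_ hδ.2
    simp only [Prod.dist_eq, sup_le_iff]
    refine ⟨⟨?_, ?_⟩, ⟨?_, ?_⟩, ?_, ?_⟩
    · exact (dist_pi_le_iff hδ.1.le).2 fun k => (hA k).1.le
    · exact (dist_pi_le_iff hδ.1.le).2 fun k => (hA k).2.le
    · exact (dist_pi_le_iff hδ.1.le).2 fun k => (hB k).1.le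
    · exact (dist_pi_le_iff hδ.1.le).2 fun k => (hB k).2.le
    · exact hc.1.le
    · exact hc.2.le
  have := hball hd
  simp only [Encloses, ctrC, radC, errC, ratVal_addC, ratVal_sumC, ratVal_mulC, ratVal_absC,
    ratVal_subC]
  exact ⟨this.1.le, this.2.le⟩

/-! ## Certified interval evaluation of a network -/

/-- An enclosure of the output of a layer and of its Jacobian matrix. -/
abbrev State := BoxPair × BoxPair

/-- Auxiliary enclosures for the passage to the next layer: of the weights, of the biases, of the
arguments of the activation function, of its Jacobian matrix, and of the Jacobian matrix of the
affine part. -/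
abbrev Aux := BoxPair × BoxPair × BoxPair × BoxPair × BoxPair

local instance : Primcodable State := inferInstance

local instance : Primcodable Aux := inferInstance

/-- The degenerate interval `{0}`. -/
def zeroI : RatCode × RatCode := ((0, 0, 0), (0, 0, 0))

/-- The degenerate interval `{1}`. -/
def oneI : RatCode × RatCode := ((1, 0, 0), (1, 0, 0))

/-- The facts in `A` and interval arithmetic justify the passage from the enclosure `s` of the
`i`-th layer to the enclosure `s'` of the next one. Here `n` is the dimension of the input, and
`m` and `k` are the sizes of the two layers. -/
def LayerCheck (A : Set Fact) (n m k i : ℕ) (s : State) (x : Aux) (s' : State) : Prop :=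
  (∀ r < k, ∀ c < m, (.inl (i, r, c, some (side x.1 (r * m + c))) : Fact) ∈ A) ∧
  (∀ r < k, (.inr (.inl (i, r, some (side x.2.1 r))) : Fact) ∈ A) ∧
  (.inr (.inr (.inr (.inl (i, some x.2.2.1, some s'.1)))) : Fact) ∈ A ∧
  (.inr (.inr (.inr (.inr (i, some x.2.2.1, some x.2.2.2.1)))) : Fact) ∈ A ∧
  (∀ r < k, Encloses m (fun c => side x.1 (r * m + c)) (fun c => side s.1 c)
    (side x.2.1 r) (side x.2.2.1 r)) ∧
  ∀ r < k, ∀ l < n,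
    Encloses m (fun c => side x.1 (r * m + c)) (fun c => side s.2 (c * n + l)) zeroI
      (side x.2.2.2.2 (r * n + l)) ∧
    Encloses k (fun j => side x.2.2.2.1 (r * k + j)) (fun j => side x.2.2.2.2 (j * n + l)) zeroI
      (side s'.2 (r * n + l))

/-- The enclosure `s` of the input layer is given by the box `b` and the identity matrix. -/
def InitCheck (n : ℕ) (b : BoxPair) (s : State) : Prop :=
  s.1 = b ∧ ∀ r < n, ∀ l < n,
    (r = l ∧ side s.2 (r * n + l) = oneI) ∨ (¬ r = l ∧ side s.2 (r * n + l) = zeroI)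

/-- The facts in `A` and interval arithmetic justify the enclosure `x.2.2.2.2` of the gradient of
the network. Here `s` is the enclosure of the last hidden layer and `m` is its size. -/
def FinalCheck (A : Set Fact) (n m : ℕ) (s : State) (x : Aux) : Prop :=
  (∀ r < m, (.inr (.inr (.inl (r, some (side x.1 r)))) : Fact) ∈ A) ∧
  ∀ l < n, Encloses m (fun r => side x.1 r) (fun r => side s.2 (r * n + l)) zeroI
    (side x.2.2.2.2 l)

/-- Certified evaluation of a network up to the `i`-th layer. -/
def Chain (A : Set Fact) (w : ℕ → ℕ) (b : BoxPair) (S : ℕ → State) (X : ℕ → Aux) (i : ℕ) : Prop :=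
  InitCheck (w 0) b (S 0) ∧
    ∀ j < i, LayerCheck A (w 0) (w j) (w (j + 1)) j (S j) (X j) (S (j + 1))

/-- Certificates for the evaluation of a network on a box. -/
abbrev Cert := List (State × Aux)

local instance : Primcodable Cert := inferInstance

/-- The enclosure of the `i`-th layer. -/
def Cert.state (T : Cert) (i : ℕ) : State := (List.getD T i default).1

/-- The auxiliary enclosures for the `i`-th layer. -/
def Cert.aux (T : Cert) (i : ℕ) : Aux := (List.getD T i default).2

/-- The facts in `A` show that `T` is a valid certificate for the evaluation on the box `b` of a
network with `H` hidden layers of the sizes `w`. -/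
def Certifies (A : Set Fact) (H : ℕ) (w : ℕ → ℕ) (b : BoxPair) (T : Cert) : Prop :=
  Chain A w b T.state T.aux H ∧ FinalCheck A (w 0) (w H) (T.state H) (T.aux H)

/-- The lower bound for the norm of the gradient. -/
def loC (n H : ℕ) (T : Cert) : RatCode :=
  sumC n fun l => subC (absC (side (T.aux H).2.2.2.2 l).1)
    (absC (subC (side (T.aux H).2.2.2.2 l).2 (side (T.aux H).2.2.2.2 l).1))

/-- The upper bound for the norm of the gradient. -/
def hiC (n H : ℕ) (T : Cert) : RatCode :=
  sumC n fun l => addC (absC (side (T.aux H).2.2.2.2 l).1)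
    (absC (subC (side (T.aux H).2.2.2.2 l).2 (side (T.aux H).2.2.2.2 l).1))

section

variable {α : Type*} [Primcodable α]

@[fun_prop]
theorem primrec_state {T : α → Cert} {i : α → ℕ} (hT : Primrec T) (hi : Primrec i) :
    Primrec fun a => (T a).state (i a) := by
  unfold Cert.state; fun_prop

@[fun_prop]
theorem primrec_aux {T : α → Cert} {i : α → ℕ} (hT : Primrec T) (hi : Primrec i) :
    Primrec fun a => (T a).aux (i a) := by
  unfold Cert.aux; fun_prop

theorem primrecPred_layerCheck {D : α → List Fact} {n m k i : α → ℕ} {s s' : α → State}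
    {x : α → Aux} (hD : Primrec D) (hn : Primrec n) (hm : Primrec m) (hk : Primrec k)
    (hi : Primrec i) (hs : Primrec s) (hx : Primrec x) (hs' : Primrec s') :
    PrimrecPred fun a => LayerCheck {f | f ∈ D a} (n a) (m a) (k a) (i a) (s a) (x a) (s' a) := by
  unfold LayerCheck
  refine .and ?_ (.and ?_ (.and ?_ (.and ?_ (.and ?_ ?_))))
  · exact primrecPred_forall_lt hk (primrecPred_forall_lt (by fun_prop)
      (primrecPred_mem (by fun_prop) (by fun_prop)))
  · exact primrecPred_forall_lt hk (primrecPred_mem (by fun_prop) (by fun_prop))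
  · exact primrecPred_mem (by fun_prop) (by fun_prop)
  · exact primrecPred_mem (by fun_prop) (by fun_prop)
  · exact primrecPred_forall_lt hk (primrecPred_encloses (by fun_prop) (by fun_prop)
      (by fun_prop) (by fun_prop) (by fun_prop))
  · exact primrecPred_forall_lt hk (primrecPred_forall_lt (by fun_prop)
      (.and (primrecPred_encloses (by fun_prop) (by fun_prop) (by fun_prop) (by fun_prop)
        (by fun_prop)) (primrecPred_encloses (by fun_prop) (by fun_prop) (by fun_prop)
        (by fun_prop) (by fun_prop))))

theorem primrecPred_certifies {D : α → List Fact} {l : α → List ℕ} {b : α → BoxPair} {T : α → Cert}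
    (hD : Primrec D) (hl : Primrec l) (hb : Primrec b) (hT : Primrec T) :
    PrimrecPred fun a => Certifies {f | f ∈ D a} ((l a).length - 1) (fun i => (l a).getD i 0)
      (b a) (T a) := by
  unfold Certifies Chain InitCheck FinalCheck
  refine .and (.and (.and ?_ ?_) ?_) (.and ?_ ?_)
  · exact primrecPred_eq (by fun_prop) (by fun_prop)
  · exact primrecPred_forall_lt (by fun_prop) (primrecPred_forall_lt (by fun_prop)
      (.or (.and (primrecPred_eq (by fun_prop) (by fun_prop))
        (primrecPred_eq (by fun_prop) (by fun_prop)))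
      (.and (.not (primrecPred_eq (by fun_prop) (by fun_prop)))
        (primrecPred_eq (by fun_prop) (by fun_prop)))))
  · exact primrecPred_forall_lt (by fun_prop) (primrecPred_layerCheck (by fun_prop) (by fun_prop)
      (by fun_prop) (by fun_prop) (by fun_prop) (by fun_prop) (by fun_prop) (by fun_prop))
  · exact primrecPred_forall_lt (by fun_prop) (primrecPred_mem (by fun_prop) (by fun_prop))
  · exact primrecPred_forall_lt (by fun_prop) (primrecPred_encloses (by fun_prop) (by fun_prop)
      (by fun_prop) (by fun_prop) (by fun_prop))

@[fun_prop]
theorem primrec_loC {n h : α → ℕ} {T : α → Cert} (hn : Primrec n) (hh : Primrec h)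
    (hT : Primrec T) : Primrec fun a => loC (n a) (h a) (T a) :=
  primrec_sumC (f := fun a l => subC (absC (side ((T a).aux (h a)).2.2.2.2 l).1)
    (absC (subC (side ((T a).aux (h a)).2.2.2.2 l).2 (side ((T a).aux (h a)).2.2.2.2 l).1))) hn
    (by fun_prop)

@[fun_prop]
theorem primrec_hiC {n h : α → ℕ} {T : α → Cert} (hn : Primrec n) (hh : Primrec h)
    (hT : Primrec T) : Primrec fun a => hiC (n a) (h a) (T a) :=
  primrec_sumC (f := fun a l => addC (absC (side ((T a).aux (h a)).2.2.2.2 l).1)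
    (absC (subC (side ((T a).aux (h a)).2.2.2.2 l).2 (side ((T a).aux (h a)).2.2.2.2 l).1))) hn
    (by fun_prop)

end

/-! ## Finitary predicates -/

/-- A predicate on sets of facts is finitary if it is monotone and if its validity depends on
finitely many facts. -/
structure Finitary (P : Set Fact → Prop) : Prop where
  mono : ∀ {A B : Set Fact}, A ⊆ B → P A → P B
  exists_list : ∀ {A : Set Fact}, P A → ∃ D : List Fact, (∀ f ∈ D, f ∈ A) ∧ P {f | f ∈ D}

namespace Finitary

theorem const (p : Prop) : Finitary fun _ => p :=
  ⟨fun _ h => h, fun h => ⟨[], by simp, h⟩⟩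

theorem mem (f : Fact) : Finitary fun A => f ∈ A :=
  ⟨fun h hf => h hf, fun h => ⟨[f], by simpa using h, by simp⟩⟩

theorem and {P Q : Set Fact → Prop} (hP : Finitary P) (hQ : Finitary Q) :
    Finitary fun A => P A ∧ Q A := by
  refine ⟨fun h hA => ⟨hP.mono h hA.1, hQ.mono h hA.2⟩, fun hA => ?_⟩
  obtain ⟨D, hD, h1⟩ := hP.exists_list hA.1
  obtain ⟨E, hE, h2⟩ := hQ.exists_list hA.2
  refine ⟨D ++ E, fun f hf => (List.mem_append.1 hf).elim (hD f) (hE f),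
    hP.mono (fun f hf => ?_) h1, hQ.mono (fun f hf => ?_) h2⟩
  · exact List.mem_append_left _ hf
  · exact List.mem_append_right _ hf

theorem or {P Q : Set Fact → Prop} (hP : Finitary P) (hQ : Finitary Q) :
    Finitary fun A => P A ∨ Q A := by
  refine ⟨fun h hA => hA.imp (hP.mono h) (hQ.mono h), fun hA => ?_⟩
  rcases hA with h | h
  · obtain ⟨D, hD, h1⟩ := hP.exists_list h
    exact ⟨D, hD, .inl h1⟩
  · obtain ⟨D, hD, h1⟩ := hQ.exists_list h
    exact ⟨D, hD, .inr h1⟩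

theorem forall_mem {β : Type*} (l : List β) {P : β → Set Fact → Prop} (hP : ∀ x, Finitary (P x)) :
    Finitary fun A => ∀ x ∈ l, P x A := by
  refine ⟨fun h hA x hx => (hP x).mono h (hA x hx), fun {A} hA => ?_⟩
  have : ∀ x, ∃ D : List Fact, (∀ f ∈ D, f ∈ A) ∧ (x ∈ l → P x {f | f ∈ D}) := by
    intro x
    by_cases hx : x ∈ l
    · obtain ⟨D, hD, h⟩ := (hP x).exists_list (hA x hx)
      exact ⟨D, hD, fun _ => h⟩
    · exact ⟨[], by simp, fun h => absurd h hx⟩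
  choose D hD h using this
  refine ⟨l.flatMap D, fun f hf => ?_, fun x hx => (hP x).mono (fun f hf => ?_) (h x hx)⟩
  · obtain ⟨x, -, hx⟩ := List.mem_flatMap.1 hf
    exact hD x f hx
  · exact List.mem_flatMap.2 ⟨x, hx, hf⟩

theorem forall_lt (n : ℕ) {P : ℕ → Set Fact → Prop} (hP : ∀ k, Finitary (P k)) :
    Finitary fun A => ∀ k < n, P k A := by
  simpa using forall_mem (List.range n) hP

end Finitary

/-- Facts enter a certificate check only as positive membership statements under bounded
quantifiers; the arithmetic conditions do not depend on `A`. -/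
theorem finitary_certifies (H : ℕ) (w : ℕ → ℕ) (b : BoxPair) (T : Cert) :
    Finitary fun A => Certifies A H w b T := by
  unfold Certifies Chain FinalCheck LayerCheck
  refine .and (.and (.const _) (.forall_lt _ fun j => ?_)) (.and ?_ (.const _))
  · exact .and (.forall_lt _ fun r => .forall_lt _ fun c => .mem _) (.and
      (.forall_lt _ fun r => .mem _) (.and (.mem _) (.and (.mem _) (.const _))))
  · exact .forall_lt _ fun r => .mem _

/-! ## Soundness and completeness of certified evaluation -/

namespace Network

variable {H : ℕ} {w : ℕ → ℕ} {N : Network H w}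

/-- Induction on the layer: a fact in `N.info` contains the true weight, bias or activation value,
because way-below implies inclusion, and `Encloses.inI` carries true values through each inner
product. -/
theorem chain_sound (hN : N.IsDifferentiable) {b : BoxPair} {S : ℕ → State} {X : ℕ → Aux}
    {x : Fin (w 0) → ℝ} (hx : ∀ j : Fin (w 0), InI (side b j) (x j)) :
    ∀ (i : ℕ) (h : i ≤ H), Chain N.info w b S X i →
      (∀ r : Fin (w i), InI (side (S i).1 r) (N.Z i h x r)) ∧
      ∀ (r : Fin (w i)) (l : Fin (w 0)), InI (side (S i).2 (r * w 0 + l)) (N.jac i h x r l)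
  | 0, h, hC => by
      obtain ⟨⟨h1, h2⟩, -⟩ := hC
      refine ⟨fun r => by rw [h1]; exact hx r, fun r l => ?_⟩
      rcases h2 r r.2 l l.2 with ⟨e, e'⟩ | ⟨e, e'⟩ <;> rw [e'] <;>
        simp [jac, InI, zeroI, oneI, Fin.ext_iff, e]
  | i + 1, h, hC => by
      obtain ⟨hz, hv⟩ := chain_sound hN hx i (Nat.le_of_succ_le h)
        ⟨hC.1, fun j hj => hC.2 j (Nat.lt_succ_of_lt hj)⟩
      obtain ⟨hW, hb, he, hg, hd, hu⟩ := hC.2 i (Nat.lt_succ_self i)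
      have hW' : ∀ (r : Fin (w (i + 1))) (c : Fin (w i)),
          InI (side (X i).1 (r * w i + c)) (N.W ⟨i, h⟩ r c) := fun r c => by
        obtain ⟨_, _, _, hwb⟩ := hW r r.2 c c.2
        exact inI_of_wayBelow hwb
      have hb' : ∀ r : Fin (w (i + 1)), InI (side (X i).2.1 r) (N.b ⟨i, h⟩ r) := fun r => by
        obtain ⟨_, _, hwb⟩ := hb r r.2
        exact inI_of_wayBelow hwb
      have hd' : ∀ r : Fin (w (i + 1)), InI (side (X i).2.2.1 r)
          (N.affine ⟨i, h⟩ (N.Z i (Nat.le_of_succ_le h) x) r) := fun r =>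
        (hd r r.2).inI (hW' r) hz (hb' r)
      have h0 : InI zeroI 0 := by simp [InI, zeroI]
      have hu' : ∀ (r : Fin (w (i + 1))) (l : Fin (w 0)),
          InI (side (X i).2.2.2.2 (r * w 0 + l))
            (∑ c, N.W ⟨i, h⟩ r c * N.jac i (Nat.le_of_succ_le h) x c l) := fun r l => by
        simpa using (hu r r.2 l l.2).1.inI (hW' r) (fun c => hv c l) h0
      refine ⟨fun r => inI_activation he hd' r, fun r l => ?_⟩
      have := (hu r r.2 l l.2).2.inI (fun j => inI_derivative (hi := h) hN hg hd' r j)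
        (fun j => hu' j l) h0
      rw [add_zero] at this
      exact this

/-- Each coordinate of the gradient differs from the first end point of its enclosure by at most the
distance of the end points; the bounds add these estimates coordinatewise. -/
theorem certifies_sound (hN : N.IsDifferentiable) {b : BoxPair} {T : Cert}
    (hT : Certifies N.info H w b T) {x : Fin (w 0) → ℝ}
    (hx : ∀ j : Fin (w 0), InI (side b j) (x j)) :
    ratVal (loC (w 0) H T) ≤ N.gradNorm x ∧ N.gradNorm x ≤ ratVal (hiC (w 0) H T) := by
  obtain ⟨-, hv⟩ := chain_sound hN hx H le_rfl hT.1
  have hg : ∀ l : Fin (w 0), InI (side (T.aux H).2.2.2.2 l) (N.grad x l) := fun l => by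
    have := (hT.2.2 l l.2).inI (x := N.Wout) (fun r => by
      obtain ⟨_, hwb⟩ := hT.2.1 r r.2
      exact inI_of_wayBelow hwb) (fun r => hv r l) (show InI zeroI 0 by simp [InI, zeroI])
    rw [add_zero] at this
    exact this
  simp only [loC, hiC, ratVal_sumC, ratVal_addC, ratVal_subC, ratVal_absC, gradNorm]
  constructor <;> refine Finset.sum_le_sum fun l _ => ?_
  · have h1 := abs_sub_left_of_mem_uIcc (hg l)
    have h2 := abs_sub_abs_le_abs_sub (ratVal (side (T.aux H).2.2.2.2 l).1) (N.grad x l)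
    rw [abs_sub_comm] at h2
    linarith
  · have h1 := abs_sub_left_of_mem_uIcc (hg l)
    have h2 := abs_sub_abs_le_abs_sub (N.grad x l) (ratVal (side (T.aux H).2.2.2.2 l).1)
    linarith

/-- Completeness of the evaluation. Tolerances are chosen backwards, from layer `i + 1` to the
input, since the argument box `d` of the activation must be fixed before the accuracy that makes the
affine part fit into it. The box `b` is only near `x` and need not contain it, so degenerate boxes
at rational points close to `x` are covered as well. -/
theorem exists_chain (hN : N.IsDifferentiable) (x : Fin (w 0) → ℝ) :
    ∀ (i : ℕ) (h : i ≤ H) {ε : ℝ}, 0 < ε → ∃ δ > 0, ∀ b : BoxPair,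
      (∀ j : Fin (w 0), Near δ (side b j) (x j)) →
      ∃ (S : ℕ → State) (X : ℕ → Aux), Chain N.info w b S X i ∧
        (∀ r : Fin (w i), Near ε (side (S i).1 r) (N.Z i h x r)) ∧
        ∀ (r : Fin (w i)) (l : Fin (w 0)),
          Near ε (side (S i).2 (r * w 0 + l)) (N.jac i h x r l)
  | 0, h, ε, hε => by
      refine ⟨ε, hε, fun b hb => ?_⟩
      obtain ⟨v, hv⟩ := exists_matBox (w 0) (w 0)
        (P := fun r l I => (r = l ∧ I = oneI) ∨ (¬ r = l ∧ I = zeroI)) fun r l => by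
          by_cases e : r = l
          · exact ⟨oneI, .inl ⟨e, rfl⟩⟩
          · exact ⟨zeroI, .inr ⟨e, rfl⟩⟩
      refine ⟨fun _ => (b, v), fun _ => default, ⟨⟨rfl, fun r hr l hl => ?_⟩, by simp⟩, hb,
        fun r l => ?_⟩
      · simpa [Fin.ext_iff] using hv ⟨r, hr⟩ ⟨l, hl⟩
      · rcases hv r l with ⟨e, e'⟩ | ⟨e, e'⟩ <;> dsimp only <;> rw [e'] <;>
          simp [jac, Near, zeroI, oneI, e, hε]
  | i + 1, h, ε, hε => by
      have h' := Nat.le_of_succ_le h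
      -- The target enclosure of the new Jacobian matrix comes first; everything else is made fine
      -- enough to land in it.
      obtain ⟨v, hv⟩ := exists_matBox _ _ fun r l => exists_near_btw (N.jac (i + 1) h x r l) hε
      have ev1 : ∀ᶠ η in 𝓝[>] (0 : ℝ), ∀ (r : Fin (w (i + 1))) (l : Fin (w 0)),
          ∀ (A B : ℕ → RatCode × RatCode) (c : RatCode × RatCode),
          (∀ k : Fin (w (i + 1)), Near η (A k)
            (jacMat (N.σ ⟨i, h⟩) (N.affine ⟨i, h⟩ (N.Z i h' x)) r k)) →
          (∀ k : Fin (w (i + 1)), Near η (B k) (∑ c, N.W ⟨i, h⟩ k c * N.jac i h' x c l)) →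
          Near η c 0 → Encloses (w (i + 1)) A B c (side v (r * w 0 + l)) :=
        eventually_all.2 fun r => eventually_all.2 fun l => eventually_encloses _ _ 0 (by
          rw [add_zero]; exact (hv r l).2.1)
      obtain ⟨η, hη, hη0⟩ := (ev1.and self_mem_nhdsWithin).exists
      -- Accuracy `ε` is what the new layer output must have, and accuracy `η` makes the product
      -- with the derivative of the activation fit into `v`.
      obtain ⟨d, e, g, hd, he, hg, hfe, hfg⟩ := exists_activation_facts hN ⟨i, h⟩
        (N.affine ⟨i, h⟩ (N.Z i h' x)) (lt_min hε hη0)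
      obtain ⟨u, hu⟩ := exists_matBox _ _ fun (r : Fin (w (i + 1))) (l : Fin (w 0)) =>
        exists_near_btw (∑ c, N.W ⟨i, h⟩ r c * N.jac i h' x c l) hη0
      have ev2 : ∀ᶠ θ in 𝓝[>] (0 : ℝ), ∀ r : Fin (w (i + 1)),
          ∀ (A B : ℕ → RatCode × RatCode) (c : RatCode × RatCode),
          (∀ k : Fin (w i), Near θ (A k) (N.W ⟨i, h⟩ r k)) →
          (∀ k : Fin (w i), Near θ (B k) (N.Z i h' x k)) →
          Near θ c (N.b ⟨i, h⟩ r) → Encloses (w i) A B c (side d r) :=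
        eventually_all.2 fun r => eventually_encloses _ _ _ (hd r)
      have ev3 : ∀ᶠ θ in 𝓝[>] (0 : ℝ), ∀ (r : Fin (w (i + 1))) (l : Fin (w 0)),
          ∀ (A B : ℕ → RatCode × RatCode) (c : RatCode × RatCode),
          (∀ k : Fin (w i), Near θ (A k) (N.W ⟨i, h⟩ r k)) →
          (∀ k : Fin (w i), Near θ (B k) (N.jac i h' x k l)) →
          Near θ c 0 → Encloses (w i) A B c (side u (r * w 0 + l)) :=
        eventually_all.2 fun r => eventually_all.2 fun l => eventually_encloses _ _ 0 (by
          rw [add_zero]; exact (hu r l).2.1)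
      -- The accuracy required of the weights, the biases and the previous layer: the affine part
      -- must land in `d` and its Jacobian matrix in `u`.
      obtain ⟨θ, ⟨hθ1, hθ2⟩, hθ0⟩ := ((ev2.and ev3).and self_mem_nhdsWithin).exists
      obtain ⟨W, hW⟩ := exists_matBox _ _ fun r c => exists_near_btw (N.W ⟨i, h⟩ r c) hθ0
      obtain ⟨β, hβ⟩ := exists_box _ fun r => exists_near_btw (N.b ⟨i, h⟩ r) hθ0
      obtain ⟨δ, hδ, IH⟩ := exists_chain hN x i h' hθ0
      refine ⟨δ, hδ, fun b hb => ?_⟩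
      obtain ⟨S, X, hC, hz, hj⟩ := IH b hb
      have near0 : ∀ {κ : ℝ}, 0 < κ → Near κ zeroI 0 := fun h => by simp [Near, zeroI, h]
      -- The chain up to layer `i` uses only the states `0, …, i` and the auxiliary data below `i`,
      -- so these updates leave it valid.
      refine ⟨Function.update S (i + 1) (e, v), Function.update X i (W, β, d, g, u), ⟨?_, ?_⟩,
        ?_, ?_⟩
      · simpa [Function.update_of_ne (Nat.succ_ne_zero i).symm] using hC.1
      · intro j hj'
        rcases Nat.lt_succ_iff_lt_or_eq.1 hj' with hlt | rfl
        · rw [Function.update_of_ne (by omega), Function.update_of_ne (by omega),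
            Function.update_of_ne (by omega)]
          exact hC.2 j hlt
        · rw [Function.update_of_ne (by omega), Function.update_self, Function.update_self]
          refine ⟨fun r hr c hc => ?_, fun r hr => ?_, hfe, hfg, fun r hr => ?_,
            fun r hr l hl => ⟨?_, ?_⟩⟩
          · exact ⟨h, hr, hc, wayBelow_of_btw (hW ⟨r, hr⟩ ⟨c, hc⟩).2.1⟩
          · exact ⟨h, hr, wayBelow_of_btw (hβ ⟨r, hr⟩).2.1⟩
          · exact hθ1 ⟨r, hr⟩ _ _ _ (fun k => (hW ⟨r, hr⟩ k).1) hz (hβ ⟨r, hr⟩).1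
          · exact hθ2 ⟨r, hr⟩ ⟨l, hl⟩ _ _ _ (fun k => (hW ⟨r, hr⟩ k).1) (fun k => hj k ⟨l, hl⟩)
              (near0 hθ0)
          · exact hη ⟨r, hr⟩ ⟨l, hl⟩ _ _ _
              (fun k => ⟨(hg ⟨r, hr⟩ k).1.trans_le (min_le_right _ _),
                (hg ⟨r, hr⟩ k).2.trans_le (min_le_right _ _)⟩)
              (fun k => (hu k ⟨l, hl⟩).1) (near0 hη0)
      · rw [Function.update_self]
        exact fun r => ⟨(he r).1.trans_le (min_le_left _ _), (he r).2.trans_le (min_le_left _ _)⟩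
      · rw [Function.update_self]
        exact fun r l => (hv r l).1

theorem exists_certifies (hN : N.IsDifferentiable) (x : Fin (w 0) → ℝ) {ε : ℝ} (hε : 0 < ε) :
    ∃ δ > 0, ∀ b : BoxPair, (∀ j : Fin (w 0), Near δ (side b j) (x j)) →
      ∃ T : Cert, Certifies N.info H w b T ∧ N.gradNorm x - ε < ratVal (loC (w 0) H T) ∧
        ratVal (hiC (w 0) H T) < N.gradNorm x + ε := by
  -- With end points closer than `η` to the gradient coordinate, the centre errs by less than `η`
  -- and the width is less than `2η`: at most `3η = ε / (n + 1)` per coordinate, hence a total below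
  -- `ε`. The `+ 1` also covers input dimension `0`.
  have hη0 : 0 < ε / (3 * ((w 0 : ℝ) + 1)) := by positivity
  obtain ⟨u, hu⟩ := exists_box _ fun l => exists_near_btw (N.grad x l) hη0
  have ev : ∀ᶠ θ in 𝓝[>] (0 : ℝ), ∀ l : Fin (w 0),
      ∀ (A B : ℕ → RatCode × RatCode) (c : RatCode × RatCode),
      (∀ k : Fin (w H), Near θ (A k) (N.Wout k)) →
      (∀ k : Fin (w H), Near θ (B k) (N.jac H le_rfl x k l)) →
      Near θ c 0 → Encloses (w H) A B c (side u l) :=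
    eventually_all.2 fun l => eventually_encloses _ _ 0 (by rw [add_zero]; exact (hu l).2.1)
  obtain ⟨θ, hθ, hθ0⟩ := (ev.and self_mem_nhdsWithin).exists
  obtain ⟨W, hW⟩ := exists_box _ fun r => exists_near_btw (N.Wout r) hθ0
  obtain ⟨δ, hδ, IH⟩ := exists_chain hN x H le_rfl hθ0
  refine ⟨δ, hδ, fun b hb => ?_⟩
  obtain ⟨S, X, hC, -, hj⟩ := IH b hb
  -- The list has `H + 1` entries. The last auxiliary slot belongs to no hidden layer and holds the
  -- output weights and the enclosure of the gradient; its unused components are filled with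
  -- defaults.
  let T : Cert := (List.range (H + 1)).map fun i =>
    (S i, if i < H then X i else (W, default, default, default, u))
  have hS : ∀ i ≤ H, T.state i = S i := fun i hi => by
    simp [T, Cert.state, List.getD, Nat.lt_succ_of_le hi]
  have hX : ∀ i < H, T.aux i = X i := fun i hi => by
    simp [T, Cert.aux, List.getD, Nat.lt_succ_of_lt hi, hi]
  have hXH : T.aux H = (W, default, default, default, u) := by
    simp [T, Cert.aux, List.getD]
  refine ⟨T, ⟨⟨?_, fun j hj => ?_⟩, fun r hr => ?_, fun l hl => ?_⟩, ?_⟩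
  · rw [hS 0 (Nat.zero_le _)]; exact hC.1
  · rw [hS j hj.le, hX j hj, hS (j + 1) hj]; exact hC.2 j hj
  · rw [hXH]; exact ⟨hr, wayBelow_of_btw (hW ⟨r, hr⟩).2.1⟩
  · rw [hXH, hS H le_rfl]
    exact hθ ⟨l, hl⟩ _ _ _ (fun k => (hW k).1) (fun k => hj k ⟨l, hl⟩) (by
      have : (0 : ℝ) < θ := hθ0
      simp [Near, zeroI, this])
  · simp only [loC, hiC, hXH, ratVal_sumC, ratVal_addC, ratVal_subC, ratVal_absC, gradNorm]
    have key : ∀ l : Fin (w 0), |(|ratVal (side u l).1| - |N.grad x l|)| +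
        |ratVal (side u l).2 - ratVal (side u l).1| ≤ ε / ((w 0 : ℝ) + 1) := fun l => by
      have h1 := (hu l).1.1
      have h2 := (hu l).1.2
      have h3 := abs_abs_sub_abs_le_abs_sub (ratVal (side u l).1) (N.grad x l)
      have h4 := abs_sub_le (ratVal (side u l).2) (N.grad x l) (ratVal (side u l).1)
      rw [abs_sub_comm (N.grad x l)] at h4
      have h5 : ε / ((w 0 : ℝ) + 1) = 3 * (ε / (3 * ((w 0 : ℝ) + 1))) := by field_simp
      linarith
    have hsum : ∑ _l : Fin (w 0), ε / ((w 0 : ℝ) + 1) < ε := by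
      rw [Finset.sum_const, Finset.card_univ, Fintype.card_fin, nsmul_eq_mul, mul_div_assoc',
        div_lt_iff₀ (by positivity)]
      linarith
    constructor
    · have : ∑ l, |N.grad x l| - ∑ l : Fin (w 0), (|ratVal (side u l).1| -
          |ratVal (side u l).2 - ratVal (side u l).1|) ≤
            ∑ _l : Fin (w 0), ε / ((w 0 : ℝ) + 1) := by
        rw [← Finset.sum_sub_distrib]
        refine Finset.sum_le_sum fun l _ => ?_
        have := neg_abs_le (|ratVal (side u l).1| - |N.grad x l|)
        linarith [key l]
      linarith
    · have : ∑ l : Fin (w 0), (|ratVal (side u l).1| +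
          |ratVal (side u l).2 - ratVal (side u l).1|) - ∑ l, |N.grad x l| ≤
            ∑ _l : Fin (w 0), ε / ((w 0 : ℝ) + 1) := by
        rw [← Finset.sum_sub_distrib]
        refine Finset.sum_le_sum fun l _ => ?_
        have := le_abs_self (|ratVal (side u l).1| - |N.grad x l|)
        linarith [key l]
      linarith

end Network

/-! ## Inclusions between finite unions of rational boxes -/

/-- The `k`-th point of a grid of width `1 / (2 * (N + 1))`. -/
def gridC (N S k : ℕ) : RatCode := (k, S, 2 * N + 1)

/-- The `j`-th coordinate of the `m`-th grid point. -/
def gridPt (g : ℕ × ℕ × ℕ) (m j : ℕ) : RatCode := gridC g.1 g.2.1 (m / g.2.2 ^ j % g.2.2)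

/-- Test on the points of a grid that every box of `Xs` lies in the union of the boxes of `Ls`. -/
def Cover (n : ℕ) (Xs Ls : List BoxPair) (g : ℕ × ℕ × ℕ) : Prop :=
  (∀ b ∈ Xs ++ Ls, ∀ j < n, (g.1 + 1) % ((side b j).1.2.2 + 1) = 0 ∧
    (g.1 + 1) % ((side b j).2.2.2 + 1) = 0) ∧
  (∀ b ∈ Xs, ∀ j < n,
    (ratVal (gridC g.1 g.2.1 0) ≤ ratVal (side b j).1 ∧
      ratVal (side b j).1 < ratVal (gridC g.1 g.2.1 g.2.2)) ∧
    (ratVal (gridC g.1 g.2.1 0) ≤ ratVal (side b j).2 ∧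
      ratVal (side b j).2 < ratVal (gridC g.1 g.2.1 g.2.2))) ∧
  ∀ m < g.2.2 ^ n, (∀ b ∈ Xs, ∃ j < n, ¬ InI (side b j) (ratVal (gridPt g m j))) ∨
    ∃ b ∈ Ls, ∀ j < n, InI (side b j) (ratVal (gridPt g m j))

section

variable {α : Type*} [Primcodable α]

theorem primrecPred_inI {I : α → RatCode × RatCode} {p : α → RatCode} (hI : Primrec I)
    (hp : Primrec p) : PrimrecPred fun a => InI (I a) (ratVal (p a)) :=
  (PrimrecPred.or
    (.and (primrecPred_le (f := fun a => (I a).1) (by fun_prop) hp)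
      (primrecPred_le (g := fun a => (I a).2) hp (by fun_prop)))
    (.and (primrecPred_le (f := fun a => (I a).2) (by fun_prop) hp)
      (primrecPred_le (g := fun a => (I a).1) hp (by fun_prop)))).of_eq fun _ => mem_uIcc.symm

@[fun_prop]
theorem primrec_gridPt {g : α → ℕ × ℕ × ℕ} {m j : α → ℕ} (hg : Primrec g) (hm : Primrec m)
    (hj : Primrec j) : Primrec fun a => gridPt (g a) (m a) (j a) := by
  unfold gridPt gridC
  fun_prop

theorem primrecPred_cover {n : α → ℕ} {Xs Ls : α → List BoxPair} {g : α → ℕ × ℕ × ℕ}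
    (hn : Primrec n) (hX : Primrec Xs) (hL : Primrec Ls) (hg : Primrec g) :
    PrimrecPred fun a => Cover (n a) (Xs a) (Ls a) (g a) := by
  unfold Cover gridC
  refine .and ?_ (.and ?_ ?_)
  · exact primrecPred_forall_mem (by fun_prop) (primrecPred_forall_lt (by fun_prop)
      (.and (primrecPred_eq (by fun_prop) (by fun_prop))
        (primrecPred_eq (by fun_prop) (by fun_prop))))
  · exact primrecPred_forall_mem (by fun_prop) (primrecPred_forall_lt (by fun_prop)
      (.and
        (.and (primrecPred_le (by fun_prop) (by fun_prop))
          (primrecPred_lt (by fun_prop) (by fun_prop)))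
        (.and (primrecPred_le (by fun_prop) (by fun_prop))
          (primrecPred_lt (by fun_prop) (by fun_prop)))))
  · refine primrecPred_forall_lt (by fun_prop) (.or ?_ ?_)
    · exact primrecPred_forall_mem (by fun_prop) (primrecPred_exists_lt (by fun_prop)
        (.not (primrecPred_inI (by fun_prop) (by fun_prop))))
    · exact primrecPred_exists_mem (by fun_prop) (primrecPred_forall_lt (by fun_prop)
        (primrecPred_inI (by fun_prop) (by fun_prop)))

end

/-- The grid number of the grid point that satisfies the same inequalities with multiples of
`1 / (N + 1)` as `y`. -/
noncomputable def snap (N : ℕ) (y : ℝ) : ℤ := ⌊((N : ℝ) + 1) * y⌋ + ⌈((N : ℝ) + 1) * y⌉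

theorem exists_int_of_aligned {N : ℕ} {q : RatCode} (h : (N + 1) % (q.2.2 + 1) = 0) :
    ∃ t : ℤ, ((N : ℝ) + 1) * ratVal q = t := by
  obtain ⟨k, hk⟩ := Nat.dvd_of_mod_eq_zero h
  refine ⟨((q.1 : ℤ) - q.2.1) * k, ?_⟩
  have hk' : (N : ℝ) + 1 = ((q.2.2 : ℝ) + 1) * k := by exact_mod_cast hk
  have : (q.2.2 : ℝ) + 1 ≠ 0 := by positivity
  rw [hk', ratVal]
  push_cast
  field_simp

/-- Let `s = (N + 1) * y` and let `t` be the integer `(N + 1) * ratVal q`. Then `t ≤ s` means `t ≤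
⌊s⌋`, and this is equivalent to `2t ≤ ⌊s⌋ + ⌈s⌉` since `⌈s⌉` exceeds `⌊s⌋` by at most one. Odd grid
numbers thus represent the open gaps between multiples of `1 / (N + 1)`. -/
theorem ratVal_le_iff_snap {N : ℕ} {q : RatCode} (h : (N + 1) % (q.2.2 + 1) = 0) (y : ℝ) :
    ratVal q ≤ y ↔ ratVal q ≤ (snap N y : ℝ) / (2 * ((N : ℝ) + 1)) := by
  obtain ⟨t, ht⟩ := exists_int_of_aligned h
  have hN : (0 : ℝ) < (N : ℝ) + 1 := by positivity
  have h1 : ratVal q ≤ y ↔ t ≤ ⌊((N : ℝ) + 1) * y⌋ := by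
    rw [Int.le_floor, ← ht, mul_le_mul_iff_right₀ hN]
  have h2 : ratVal q ≤ (snap N y : ℝ) / (2 * ((N : ℝ) + 1)) ↔ 2 * t ≤ snap N y := by
    rw [le_div_iff₀ (by positivity), ← Int.cast_le (R := ℝ)]
    push_cast
    rw [← ht]
    constructor <;> intro h <;> linarith
  rw [h1, h2, snap]
  have := Int.floor_le_ceil (((N : ℝ) + 1) * y)
  have := Int.ceil_le_floor_add_one (((N : ℝ) + 1) * y)
  omega

theorem le_ratVal_iff_snap {N : ℕ} {q : RatCode} (h : (N + 1) % (q.2.2 + 1) = 0) (y : ℝ) :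
    y ≤ ratVal q ↔ (snap N y : ℝ) / (2 * ((N : ℝ) + 1)) ≤ ratVal q := by
  obtain ⟨t, ht⟩ := exists_int_of_aligned h
  have hN : (0 : ℝ) < (N : ℝ) + 1 := by positivity
  have h1 : y ≤ ratVal q ↔ ⌈((N : ℝ) + 1) * y⌉ ≤ t := by
    rw [Int.ceil_le, ← ht, mul_le_mul_iff_right₀ hN]
  have h2 : (snap N y : ℝ) / (2 * ((N : ℝ) + 1)) ≤ ratVal q ↔ snap N y ≤ 2 * t := by
    rw [div_le_iff₀ (by positivity), ← Int.cast_le (R := ℝ)]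
    push_cast
    rw [← ht]
    constructor <;> intro h <;> linarith
  rw [h1, h2, snap]
  have := Int.floor_le_ceil (((N : ℝ) + 1) * y)
  have := Int.ceil_le_floor_add_one (((N : ℝ) + 1) * y)
  omega

theorem inI_iff_snap {N : ℕ} {I : RatCode × RatCode} (h1 : (N + 1) % (I.1.2.2 + 1) = 0)
    (h2 : (N + 1) % (I.2.2.2 + 1) = 0) (y : ℝ) :
    InI I y ↔ InI I ((snap N y : ℝ) / (2 * ((N : ℝ) + 1))) := by
  rw [InI, InI, mem_uIcc, mem_uIcc, ← ratVal_le_iff_snap h1, ← ratVal_le_iff_snap h2,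
    ← le_ratVal_iff_snap h1, ← le_ratVal_iff_snap h2]

theorem ratVal_gridC (N S k : ℕ) :
    ratVal (gridC N S k) = ((k : ℝ) - S) / (2 * ((N : ℝ) + 1)) := by
  simp only [ratVal, gridC]
  push_cast
  ring

/-- The box with the code `b` contains `x`. -/
def InBox (n : ℕ) (b : BoxPair) (x : Fin n → ℝ) : Prop := ∀ j : Fin n, InI (side b j) (x j)

/-- Snapping every coordinate of `x` preserves membership in each listed box, because all their
corners are multiples of `1 / (N + 1)`. The range condition places the snapped point among the
tested grid points, where the test supplies a box of `Ls`. -/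
theorem Cover.sound {n : ℕ} {Xs Ls : List BoxPair} {g : ℕ × ℕ × ℕ} (h : Cover n Xs Ls g)
    {x : Fin n → ℝ} {b : BoxPair} (hb : b ∈ Xs) (hx : InBox n b x) : ∃ l ∈ Ls, InBox n l x := by
  obtain ⟨N, S, R⟩ := g
  obtain ⟨hal, hin, hgrid⟩ := h
  simp only at hal hin hgrid
  have hN : (0 : ℝ) < 2 * ((N : ℝ) + 1) := by positivity
  have hsnap : ∀ b ∈ Xs ++ Ls, ∀ j : Fin n, InI (side b j) (x j) ↔
      InI (side b j) ((snap N (x j) : ℝ) / (2 * ((N : ℝ) + 1))) := fun b hb j =>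
    inI_iff_snap (hal b hb j j.2).1 (hal b hb j j.2).2 _
  have hk : ∀ j : Fin n, ∃ k : Fin R,
      (snap N (x j) : ℝ) / (2 * ((N : ℝ) + 1)) = ratVal (gridC N S k) := by
    intro j
    have h1 := (hsnap b (List.mem_append_left _ hb) j).1 (hx j)
    have h2 := hin b hb j j.2
    simp only [ratVal_gridC] at h2
    have h3 : ((0 : ℕ) - (S : ℝ)) / (2 * ((N : ℝ) + 1)) ≤
        (snap N (x j) : ℝ) / (2 * ((N : ℝ) + 1)) := by
      rcases mem_uIcc.1 h1 with h | h
      · exact h2.1.1.trans h.1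
      · exact h2.2.1.trans h.1
    have h4 : (snap N (x j) : ℝ) / (2 * ((N : ℝ) + 1)) < ((R : ℝ) - S) / (2 * ((N : ℝ) + 1)) := by
      rcases mem_uIcc.1 h1 with h | h
      · exact h.2.trans_lt h2.2.2
      · exact h.2.trans_lt h2.1.2
    rw [div_le_div_iff_of_pos_right hN] at h3
    rw [div_lt_div_iff_of_pos_right hN] at h4
    have h3' : (0 : ℤ) ≤ snap N (x j) + S := by
      have : (0 : ℝ) ≤ ((snap N (x j) + S : ℤ) : ℝ) := by push_cast at h3 ⊢; linarith
      exact_mod_cast this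
    have h4' : snap N (x j) + S < (R : ℤ) := by
      have : ((snap N (x j) + S : ℤ) : ℝ) < ((R : ℤ) : ℝ) := by push_cast; linarith
      exact_mod_cast this
    refine ⟨⟨(snap N (x j) + S).toNat, by omega⟩, ?_⟩
    rw [ratVal_gridC]
    congr 1
    have : (((snap N (x j) + S).toNat : ℤ) : ℝ) = ((snap N (x j) + S : ℤ) : ℝ) := by
      rw [Int.toNat_of_nonneg h3']
    rw [Int.cast_natCast] at this
    rw [this]
    push_cast
    ring
  choose k hk using hk
  -- A grid point is indexed by the number whose base-`R` digits are the grid numbers of its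
  -- coordinates.
  let m : Fin (R ^ n) := finFunctionFinEquiv k
  have hm : ∀ j : Fin n, (m : ℕ) / R ^ (j : ℕ) % R = k j := fun j => by
    have := finFunctionFinEquiv_symm_apply_val m j
    rw [← this]
    simp [m]
  have hpt : ∀ j : Fin n, ratVal (gridPt (N, S, R) m j) =
      (snap N (x j) : ℝ) / (2 * ((N : ℝ) + 1)) := fun j => by
    rw [gridPt, hm, hk]
  rcases hgrid m m.2 with h | ⟨l, hl, h⟩
  · obtain ⟨j, hj, hne⟩ := h b hb
    refine absurd ?_ hne
    have := (hsnap b (List.mem_append_left _ hb) ⟨j, hj⟩).1 (hx ⟨j, hj⟩)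
    rwa [← hpt ⟨j, hj⟩] at this
  · refine ⟨l, hl, fun j => (hsnap l (List.mem_append_right _ hl) j).2 ?_⟩
    rw [← hpt j]
    exact h j j.2

theorem exists_common_denominator (l : List RatCode) :
    ∃ N : ℕ, ∀ q ∈ l, (N + 1) % (q.2.2 + 1) = 0 := by
  induction l with
  | nil => exact ⟨0, by simp⟩
  | cons p l ih =>
    obtain ⟨N, hN⟩ := ih
    have e : (N + 1) * (p.2.2 + 1) - 1 + 1 = (N + 1) * (p.2.2 + 1) :=
      Nat.sub_add_cancel (Nat.mul_pos (Nat.succ_pos _) (Nat.succ_pos _))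
    refine ⟨(N + 1) * (p.2.2 + 1) - 1, fun q hq => ?_⟩
    rw [e]
    rcases List.mem_cons.1 hq with rfl | hq
    · simp
    · exact Nat.mod_eq_zero_of_dvd ((Nat.dvd_of_mod_eq_zero (hN q hq)).mul_right _)

theorem exists_abs_ratVal_lt (l : List RatCode) : ∃ B : ℕ, ∀ q ∈ l, |ratVal q| < B := by
  induction l with
  | nil => exact ⟨0, by simp⟩
  | cons p l ih =>
    obtain ⟨B, hB⟩ := ih
    obtain ⟨C, hC⟩ := exists_nat_gt |ratVal p|
    refine ⟨max B C, fun q hq => ?_⟩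
    rw [Nat.cast_max, lt_max_iff]
    rcases List.mem_cons.1 hq with rfl | hq
    · exact .inr hC
    · exact .inl (hB q hq)

/-- Grid points are genuine points, so a true inclusion passes the test on every grid that is fine
and large enough. -/
theorem exists_cover {n : ℕ} {Xs Ls : List BoxPair}
    (h : ∀ b ∈ Xs, ∀ x : Fin n → ℝ, InBox n b x → ∃ l ∈ Ls, InBox n l x) :
    ∃ g, Cover n Xs Ls g := by
  let codes : List RatCode := (Xs ++ Ls).flatMap fun b => (List.range n).flatMap fun j =>
    [(side b j).1, (side b j).2]
  have hcodes : ∀ b ∈ Xs ++ Ls, ∀ j < n, (side b j).1 ∈ codes ∧ (side b j).2 ∈ codes :=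
    fun b hb j hj =>
      ⟨List.mem_flatMap.2 ⟨b, hb, List.mem_flatMap.2 ⟨j, List.mem_range.2 hj, by simp⟩⟩,
        List.mem_flatMap.2 ⟨b, hb, List.mem_flatMap.2 ⟨j, List.mem_range.2 hj, by simp⟩⟩⟩
  obtain ⟨N, hN⟩ := exists_common_denominator codes
  obtain ⟨B, hB⟩ := exists_abs_ratVal_lt codes
  have hpos : (0 : ℝ) < 2 * ((N : ℝ) + 1) := by positivity
  have h0 : ratVal (gridC N (2 * (N + 1) * B) 0) = -B := by
    rw [ratVal_gridC, div_eq_iff hpos.ne']; push_cast; ring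
  have h1 : ratVal (gridC N (2 * (N + 1) * B) (4 * (N + 1) * B)) = B := by
    rw [ratVal_gridC, div_eq_iff hpos.ne']; push_cast; ring
  -- The shift `2 * (N + 1) * B` puts grid number `0` at `-B`, and the length `4 * (N + 1) * B` puts
  -- the excluded end at `B`, where `B` bounds all corners strictly.
  refine ⟨(N, 2 * (N + 1) * B, 4 * (N + 1) * B), fun b hb j hj =>
    ⟨hN _ (hcodes b hb j hj).1, hN _ (hcodes b hb j hj).2⟩, fun b hb j hj => ?_, fun m _ => ?_⟩
  · have hc := hcodes b (List.mem_append_left _ hb) j hj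
    have h2 := abs_lt.1 (hB _ hc.1)
    have h3 := abs_lt.1 (hB _ hc.2)
    rw [h0, h1]
    exact ⟨⟨h2.1.le, h2.2⟩, ⟨h3.1.le, h3.2⟩⟩
  · rw [or_iff_not_imp_left]
    intro hne
    push Not at hne
    obtain ⟨b, hb, hin⟩ := hne
    obtain ⟨l, hl, hl'⟩ := h b hb (fun j => ratVal (gridPt (N, 2 * (N + 1) * B, 4 * (N + 1) * B) m j))
      fun j => hin j j.2
    exact ⟨l, hl, fun j hj => hl' ⟨j, hj⟩⟩

theorem mem_unionVal {n : ℕ} {c : UnionCode} {x : Fin n → ℝ} :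
    x ∈ unionVal n c ↔ ∃ b ∈ c.1 :: c.2, InBox n b x := by
  simp only [unionVal, mem_iUnion₂, exists_prop]
  exact exists_congr fun b => and_congr_right fun _ => mem_uIcc_pi

/-- Compact sets are covered by finitely many rational boxes with a property that holds for some
rational neighbourhood of every point. -/
theorem exists_list_of_isCompact {n : ℕ} {β : Type*} (box : β → BoxPair) {P : β → Prop}
    {X : Set (Fin n → ℝ)} (hX : IsCompact X)
    (h : ∀ x ∈ X, ∃ a, (∀ j : Fin n, Btw (side (box a) j) (x j)) ∧ P a) :
    ∃ L : List β, (∀ a ∈ L, P a) ∧ ∀ x ∈ X, ∃ a ∈ L, ∀ j : Fin n, Btw (side (box a) j) (x j) := by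
  refine hX.induction_on (p := fun X => ∃ L : List β, (∀ a ∈ L, P a) ∧
    ∀ x ∈ X, ∃ a ∈ L, ∀ j : Fin n, Btw (side (box a) j) (x j)) ⟨[], by simp⟩ ?_ ?_ ?_
  · rintro s t hst ⟨L, h1, h2⟩
    exact ⟨L, h1, fun x hx => h2 x (hst hx)⟩
  · rintro s t ⟨L, h1, h2⟩ ⟨K, h3, h4⟩
    refine ⟨L ++ K, fun a ha => (List.mem_append.1 ha).elim (h1 a) (h3 a), fun x hx => ?_⟩
    rcases hx with hx | hx
    · obtain ⟨a, ha, ha'⟩ := h2 x hx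
      exact ⟨a, List.mem_append_left _ ha, ha'⟩
    · obtain ⟨a, ha, ha'⟩ := h4 x hx
      exact ⟨a, List.mem_append_right _ ha, ha'⟩
  · intro x hx
    obtain ⟨a, ha, hP⟩ := h x hx
    have ho : IsOpen {y : Fin n → ℝ | ∀ j : Fin n, Btw (side (box a) j) (y j)} := by
      simp only [Btw, ofPred_forall]
      exact isOpen_iInter_of_finite fun j => (isOpen_lt continuous_const (continuous_apply j)).inter
        (isOpen_lt (continuous_apply j) continuous_const)
    exact ⟨_, mem_nhdsWithin_of_mem_nhds (ho.mem_nhds ha), [a], by simpa using hP,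
      fun y hy => ⟨a, by simp, hy⟩⟩

/-- If `x` is the smaller end point it is itself rational, which also settles degenerate intervals;
otherwise there is a rational number just below `x` inside the interval. -/
theorem exists_ratVal_mem {I : RatCode × RatCode} {x δ : ℝ} (hx : InI I x) (hδ : 0 < δ) :
    ∃ c : RatCode, InI I (ratVal c) ∧ |ratVal c - x| < δ := by
  obtain ⟨a, b, ha, hb, h1, h2⟩ : ∃ a b : RatCode, ratVal a ≤ x ∧ x ≤ ratVal b ∧
      (InI I (ratVal a)) ∧ InI I (ratVal b) := by
    rcases mem_uIcc.1 hx with h | h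
    · exact ⟨I.1, I.2, h.1, h.2, left_mem_uIcc, right_mem_uIcc⟩
    · exact ⟨I.2, I.1, h.1, h.2, right_mem_uIcc, left_mem_uIcc⟩
  rcases ha.eq_or_lt with h | h
  · exact ⟨a, h1, by simpa [h] using hδ⟩
  · obtain ⟨c, hc1, hc2⟩ := exists_ratVal_btwn (max_lt h (sub_lt_self x hδ))
    refine ⟨c, ?_, ?_⟩
    · exact uIcc_subset_uIcc h1 h2 (Icc_subset_uIcc
        ⟨(le_max_left _ _).trans hc1.le, hc2.le.trans hb⟩)
    · have := (le_max_right _ _).trans_lt hc1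
      rw [abs_lt]; constructor <;> linarith

theorem exists_rational_mem_unionVal {n : ℕ} {c : UnionCode} {x : Fin n → ℝ} {δ : ℝ}
    (hx : x ∈ unionVal n c) (hδ : 0 < δ) : ∃ y : List RatCode, vecVal n y ∈ unionVal n c ∧
      ∀ j : Fin n, Near δ (side (y, y) j) (x j) := by
  obtain ⟨b, hb, hxb⟩ := mem_unionVal.1 hx
  obtain ⟨d, hd⟩ := exists_box n (P := fun j I => InI (side b j) (ratVal I.1) ∧
    |ratVal I.1 - x j| < δ) fun j => by
      obtain ⟨c, hc⟩ := exists_ratVal_mem (hxb j) hδ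
      exact ⟨(c, c), hc⟩
  exact ⟨d.1, mem_unionVal.2 ⟨b, hb, fun j => (hd j).1⟩, fun j => ⟨(hd j).2, (hd j).2⟩⟩

/-! ## The effective procedures -/

/-- `Certifies` for the network architecture with the list `l` of layer sizes. -/
def ArchCertifies (A : Set Fact) (l : List ℕ) (b : BoxPair) (T : Cert) : Prop :=
  Certifies A (l.length - 1) (fun i => l.getD i 0) b T

/-- The lower bound for the norm of the gradient, for the list `l` of layer sizes. -/
def archLo (l : List ℕ) (T : Cert) : RatCode := loC (l.getD 0 0) (l.length - 1) T

/-- The upper bound for the norm of the gradient, for the list `l` of layer sizes. -/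
def archHi (l : List ℕ) (T : Cert) : RatCode := hiC (l.getD 0 0) (l.length - 1) T

/-- `y` is a point of the union of boxes `x`, and `T` certifies the evaluation at `y`. -/
def PointCheck (A : Set Fact) (l : List ℕ) (x : UnionCode) (y : List RatCode) (T : Cert)
    (g : ℕ × ℕ × ℕ) : Prop :=
  ArchCertifies A l (y, y) T ∧ Cover (l.getD 0 0) [(y, y)] (x.1 :: x.2) g

local instance : Primcodable (ℕ × ℕ × ℕ) := inferInstance

local instance : Primcodable (BoxPair × Cert) := inferInstance

local instance : Primcodable (BoxPair × Cert × BoxPair) := inferInstance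

/-- Certificates for the approximation of the maximum value: a rational point with a certificate
for its evaluation, boxes with certificates for their evaluation, and two grids. -/
abbrev ValueCert :=
  List RatCode × Cert × List (BoxPair × Cert) × (ℕ × ℕ × ℕ) × (ℕ × ℕ × ℕ)

local instance : Primcodable ValueCert := inferInstance

/-- The certificate `c` shows that the interval `e` is way below the maximum value. -/
def ValueCheck (A : Set Fact) (l : List ℕ) (x : UnionCode) (e : IntervalCode) (c : ValueCert) :
    Prop :=
  e = none ∨ (PointCheck A l x c.1 c.2.1 c.2.2.2.1 ∧
    (ratVal (e.getD zeroI).1 < ratVal (archLo l c.2.1) ∨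
      ratVal (e.getD zeroI).2 < ratVal (archLo l c.2.1)) ∧
    Cover (l.getD 0 0) (x.1 :: x.2) (c.2.2.1.map Prod.fst) c.2.2.2.2 ∧
    ∀ a ∈ c.2.2.1, ArchCertifies A l a.1 a.2 ∧
      (ratVal (archHi l a.2) < ratVal (e.getD zeroI).1 ∨
        ratVal (archHi l a.2) < ratVal (e.getD zeroI).2))

/-- The interval `I` lies strictly inside the interval `J`. -/
def Inside (I J : RatCode × RatCode) : Prop :=
  (ratVal J.1 < ratVal I.1 ∧ ratVal J.1 < ratVal I.2) ∧
    (ratVal I.1 < ratVal J.2 ∧ ratVal I.2 < ratVal J.2)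

/-- Certificates for the approximation of the maximum set: a rational point with a certificate for
its evaluation, boxes with certificates for their evaluation and larger boxes, and three grids. -/
abbrev SetCert :=
  List RatCode × Cert × List (BoxPair × Cert × BoxPair) ×
    (ℕ × ℕ × ℕ) × (ℕ × ℕ × ℕ) × (ℕ × ℕ × ℕ)

local instance : Primcodable SetCert := inferInstance

/-- The certificate `c` shows that the union of boxes `k` is way below the maximum set. -/
def SetCheck (A : Set Fact) (l : List ℕ) (x : UnionCode) (k : Option UnionCode) (c : SetCert) :
    Prop :=
  k = none ∨ (PointCheck A l x c.1 c.2.1 c.2.2.2.1 ∧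
    Cover (l.getD 0 0) (x.1 :: x.2) (c.2.2.1.map fun a => a.1) c.2.2.2.2.1 ∧
    (∀ a ∈ c.2.2.1,
      (ArchCertifies A l a.1 a.2.1 ∧ ratVal (archHi l a.2.1) < ratVal (archLo l c.2.1)) ∨
      ∀ j < l.getD 0 0, Inside (side a.1 j) (side a.2.2 j)) ∧
    Cover (l.getD 0 0) (c.2.2.1.map fun a => a.2.2)
      ((k.getD (([], []), [])).1 :: (k.getD (([], []), [])).2) c.2.2.2.2.2)

section

variable {α : Type*} [Primcodable α]

theorem primrecPred_pointCheck {D : α → List Fact} {l : α → List ℕ} {x : α → UnionCode}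
    {y : α → List RatCode} {T : α → Cert} {g : α → ℕ × ℕ × ℕ} (hD : Primrec D) (hl : Primrec l)
    (hx : Primrec x) (hy : Primrec y) (hT : Primrec T) (hg : Primrec g) :
    PrimrecPred fun a => PointCheck {f | f ∈ D a} (l a) (x a) (y a) (T a) (g a) := by
  unfold PointCheck ArchCertifies
  exact .and (primrecPred_certifies hD hl (by fun_prop) hT)
    (primrecPred_cover (by fun_prop) (by fun_prop) (by fun_prop) hg)

@[fun_prop]
theorem primrec_archLo {l : α → List ℕ} {T : α → Cert} (hl : Primrec l) (hT : Primrec T) :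
    Primrec fun a => archLo (l a) (T a) := by
  unfold archLo; fun_prop

@[fun_prop]
theorem primrec_archHi {l : α → List ℕ} {T : α → Cert} (hl : Primrec l) (hT : Primrec T) :
    Primrec fun a => archHi (l a) (T a) := by
  unfold archHi; fun_prop

theorem primrecPred_valueCheck {D : α → List Fact} {l : α → List ℕ} {x : α → UnionCode}
    {e : α → IntervalCode} {c : α → ValueCert} (hD : Primrec D) (hl : Primrec l)
    (hx : Primrec x) (he : Primrec e) (hc : Primrec c) :
    PrimrecPred fun a => ValueCheck {f | f ∈ D a} (l a) (x a) (e a) (c a) := by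
  unfold ValueCheck
  refine .or (primrecPred_eq he (by fun_prop)) (.and ?_ (.and ?_ (.and ?_ ?_)))
  · exact primrecPred_pointCheck hD hl hx (by fun_prop) (by fun_prop) (by fun_prop)
  · exact .or (primrecPred_lt (by fun_prop) (by fun_prop))
      (primrecPred_lt (by fun_prop) (by fun_prop))
  · exact primrecPred_cover (by fun_prop) (by fun_prop)
      (Primrec.list_map (by fun_prop) (Primrec.fst.comp Primrec.snd)) (by fun_prop)
  · exact primrecPred_forall_mem (by fun_prop) (.and
      (primrecPred_certifies (by fun_prop) (by fun_prop) (by fun_prop) (by fun_prop))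
      (.or (primrecPred_lt (by fun_prop) (by fun_prop))
        (primrecPred_lt (by fun_prop) (by fun_prop))))

theorem primrecPred_setCheck {D : α → List Fact} {l : α → List ℕ} {x : α → UnionCode}
    {k : α → Option UnionCode} {c : α → SetCert} (hD : Primrec D) (hl : Primrec l)
    (hx : Primrec x) (hk : Primrec k) (hc : Primrec c) :
    PrimrecPred fun a => SetCheck {f | f ∈ D a} (l a) (x a) (k a) (c a) := by
  unfold SetCheck Inside
  refine .or (primrecPred_eq hk (by fun_prop)) (.and ?_ (.and ?_ (.and ?_ ?_)))
  · exact primrecPred_pointCheck hD hl hx (by fun_prop) (by fun_prop) (by fun_prop)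
  · exact primrecPred_cover (by fun_prop) (by fun_prop)
      (Primrec.list_map (by fun_prop) (Primrec.fst.comp Primrec.snd)) (by fun_prop)
  · refine primrecPred_forall_mem (by fun_prop) (.or (.and
      (primrecPred_certifies (by fun_prop) (by fun_prop) (by fun_prop) (by fun_prop))
      (primrecPred_lt (by fun_prop) (by fun_prop))) (primrecPred_forall_lt (by fun_prop) ?_))
    exact .and
      (.and (primrecPred_lt (by fun_prop) (by fun_prop))
        (primrecPred_lt (by fun_prop) (by fun_prop)))
      (.and (primrecPred_lt (by fun_prop) (by fun_prop))
        (primrecPred_lt (by fun_prop) (by fun_prop)))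
  · exact primrecPred_cover (by fun_prop)
      (Primrec.list_map (by fun_prop) (Primrec.snd.comp (Primrec.snd.comp Primrec.snd)))
      (by fun_prop) (by fun_prop)

end

theorem finitary_valueCheck (l : List ℕ) (x : UnionCode) (e : IntervalCode) (c : ValueCert) :
    Finitary fun A => ValueCheck A l x e c :=
  .or (.const _) (.and (.and (finitary_certifies _ _ _ _) (.const _)) (.and (.const _)
    (.and (.const _) (.forall_mem _ fun _ => .and (finitary_certifies _ _ _ _) (.const _)))))

theorem finitary_setCheck (l : List ℕ) (x : UnionCode) (k : Option UnionCode) (c : SetCert) :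
    Finitary fun A => SetCheck A l x k c :=
  .or (.const _) (.and (.and (finitary_certifies _ _ _ _) (.const _)) (.and (.const _)
    (.and (.forall_mem _ fun _ => .or (.and (finitary_certifies _ _ _ _) (.const _)) (.const _))
      (.const _))))

/-- The graph of the procedure for the maximum value. -/
def ValueGraph (p : List Fact × (List ℕ × UnionCode × IntervalCode)) : Prop :=
  ∃ c, ValueCheck {f | f ∈ p.1} p.2.1 p.2.2.1 p.2.2.2 c

/-- The graph of the procedure for the maximum set. -/
def SetGraph (p : List Fact × (List ℕ × UnionCode × Option UnionCode)) : Prop :=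
  ∃ c, SetCheck {f | f ∈ p.1} p.2.1 p.2.2.1 p.2.2.2 c

theorem rePred_valueGraph : REPred ValueGraph :=
  REPred.of_exists_primrec (primrecPred_valueCheck (by fun_prop) (by fun_prop) (by fun_prop)
    (by fun_prop) (by fun_prop))

theorem rePred_setGraph : REPred SetGraph :=
  REPred.of_exists_primrec (primrecPred_setCheck (by fun_prop) (by fun_prop) (by fun_prop)
    (by fun_prop) (by fun_prop))

/-- Monotonicity lifts a check on a finite list to all of `A`; finitariness extracts such a list
from a check on `A`. The operator can therefore be analysed with the full information at hand. -/
theorem mem_outputs_iff {Q C : Type*} {P : Set Fact → Q → C → Prop}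
    (hP : ∀ q c, Finitary fun A => P A q c) (A : Set Fact) (q : Q) :
    q ∈ outputs (fun p : List Fact × Q => ∃ c, P {f | f ∈ p.1} p.2 c) A ↔ ∃ c, P A q c := by
  constructor
  · rintro ⟨D, hD, c, h⟩
    exact ⟨c, (hP q c).mono hD h⟩
  · rintro ⟨c, h⟩
    obtain ⟨D, hD, h⟩ := (hP q c).exists_list h
    exact ⟨D, hD, c, h⟩

theorem mem_outputs_valueGraph (A : Set Fact) (l : List ℕ) (x : UnionCode) (e : IntervalCode) :
    (l, x, e) ∈ outputs ValueGraph A ↔ ∃ c, ValueCheck A l x e c :=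
  mem_outputs_iff (P := fun A (q : List ℕ × UnionCode × IntervalCode) c =>
    ValueCheck A q.1 q.2.1 q.2.2 c) (fun _ _ => finitary_valueCheck _ _ _ _) A (l, x, e)

theorem mem_outputs_setGraph (A : Set Fact) (l : List ℕ) (x : UnionCode) (k : Option UnionCode) :
    (l, x, k) ∈ outputs SetGraph A ↔ ∃ c, SetCheck A l x k c :=
  mem_outputs_iff (P := fun A (q : List ℕ × UnionCode × Option UnionCode) c =>
    SetCheck A q.1 q.2.1 q.2.2 c) (fun _ _ => finitary_setCheck _ _ _ _) A (l, x, k)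

theorem length_arch (H : ℕ) (w : ℕ → ℕ) : (arch H w).length - 1 = H := by simp [arch]

theorem getD_arch {H : ℕ} (w : ℕ → ℕ) {i : ℕ} (hi : i ≤ H) : (arch H w).getD i 0 = w i := by
  simp [arch, List.getD, Nat.lt_succ_of_le hi]

/-- A certificate refers only to the sizes `w 0, …, w H`, which the list records; the default value
of `getD` is never reached. -/
theorem archCertifies_arch {A : Set Fact} {H : ℕ} {w : ℕ → ℕ} {b : BoxPair} {T : Cert} :
    ArchCertifies A (arch H w) b T ↔ Certifies A H w b T := by
  unfold ArchCertifies Certifies Chain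
  beta_reduce
  rw [length_arch, getD_arch w (Nat.zero_le H), getD_arch w le_rfl]
  refine and_congr_left' (and_congr_right' (forall₂_congr fun j hj => ?_))
  rw [getD_arch w hj.le, getD_arch w hj]

theorem archLo_arch (H : ℕ) (w : ℕ → ℕ) (T : Cert) : archLo (arch H w) T = loC (w 0) H T := by
  rw [archLo, length_arch, getD_arch w (Nat.zero_le H)]

theorem archHi_arch (H : ℕ) (w : ℕ → ℕ) (T : Cert) : archHi (arch H w) T = hiC (w 0) H T := by
  rw [archHi, length_arch, getD_arch w (Nat.zero_le H)]

theorem Inside.btw {I J : RatCode × RatCode} {x : ℝ} (h : Inside I J) (hx : InI I x) : Btw J x := by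
  obtain ⟨⟨h1, h2⟩, h3, h4⟩ := h
  rcases mem_uIcc.1 hx with hx | hx
  · exact ⟨h1.trans_le hx.1, hx.2.trans_lt h4⟩
  · exact ⟨h2.trans_le hx.1, hx.2.trans_lt h3⟩

theorem exists_inside (x : ℝ) {r : ℝ} (hr : 0 < r) :
    ∃ I J, Btw I x ∧ Inside I J ∧ Near r J x := by
  obtain ⟨J, h1, -, h2, h3⟩ := exists_near_btw x hr
  obtain ⟨I, h4, h5, -⟩ := exists_near_btw x (half_pos hr)
  have h6 := abs_lt.1 h4.1
  have h7 := abs_lt.1 h4.2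
  exact ⟨I, J, h5, ⟨⟨by linarith, by linarith⟩, by linarith, by linarith⟩, h1⟩

/-! ### Correctness of the certificates for maximum value and maximum set -/

namespace Network

variable {H : ℕ} {w : ℕ → ℕ} {N : Network H w}

theorem pointCheck_sound (hN : N.IsDifferentiable) {x : UnionCode} {y : List RatCode} {T : Cert}
    {g : ℕ × ℕ × ℕ} (h : PointCheck N.info (arch H w) x y T g) :
    vecVal (w 0) y ∈ unionVal (w 0) x ∧
      ratVal (archLo (arch H w) T) ≤ N.gradNorm (vecVal (w 0) y) := by
  have hy : InBox (w 0) (y, y) (vecVal (w 0) y) := fun j => left_mem_uIcc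
  obtain ⟨h1, h2⟩ := h
  rw [getD_arch w (Nat.zero_le H)] at h2
  rw [archCertifies_arch] at h1
  rw [archLo_arch]
  exact ⟨mem_unionVal.2 (h2.sound (by simp) hy), (certifies_sound hN h1 hy).1⟩

/-- The point `y₀` may be irrational, but rational points are dense in the union, and
`exists_certifies` gives nearly the value at `y₀` on the degenerate box of any rational point close
to it. -/
theorem exists_pointCheck (hN : N.IsDifferentiable) {x : UnionCode} {y₀ : Fin (w 0) → ℝ}
    (hy₀ : y₀ ∈ unionVal (w 0) x) {s : ℝ} (hs : s < N.gradNorm y₀) :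
    ∃ y T g, PointCheck N.info (arch H w) x y T g ∧ s < ratVal (archLo (arch H w) T) := by
  obtain ⟨δ, hδ, h⟩ := exists_certifies hN y₀ (sub_pos.2 hs)
  obtain ⟨y, hy, hnear⟩ := exists_rational_mem_unionVal hy₀ hδ
  obtain ⟨T, hT, hlo, -⟩ := h (y, y) hnear
  obtain ⟨g, hg⟩ := exists_cover (n := w 0) (Xs := [(y, y)]) (Ls := x.1 :: x.2) fun b hb z hz => by
    rw [List.mem_singleton.1 hb] at hz
    have : z = vecVal (w 0) y := funext fun j => by
      have h : z j ∈ uIcc (vecVal (w 0) y j) (vecVal (w 0) y j) := hz j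
      simpa only [uIcc_self, mem_singleton_iff] using h
    exact mem_unionVal.1 (this ▸ hy)
  refine ⟨y, T, g, ⟨archCertifies_arch.2 hT, ?_⟩, ?_⟩
  · rwa [getD_arch w (Nat.zero_le H)]
  · rw [archLo_arch]; linarith

theorem exists_certified_box (hN : N.IsDifferentiable) (z : Fin (w 0) → ℝ) {s : ℝ}
    (hs : N.gradNorm z < s) : ∃ (b : BoxPair) (T : Cert), (∀ j : Fin (w 0), Btw (side b j) (z j)) ∧
      ArchCertifies N.info (arch H w) b T ∧ ratVal (archHi (arch H w) T) < s := by
  obtain ⟨δ, hδ, h⟩ := exists_certifies hN z (sub_pos.2 hs)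
  obtain ⟨b, hb⟩ := exists_box _ fun j => exists_near_btw (z j) hδ
  obtain ⟨T, hT, -, hhi⟩ := h b fun j => (hb j).1
  refine ⟨b, T, fun j => (hb j).2.1, archCertifies_arch.2 hT, ?_⟩
  rw [archHi_arch]; linarith

/-- Soundness: the certified point bounds the maximum from below, and `y₀` itself lies in one of the
covering boxes, whose upper bound applies to it. Completeness: the left end is passed by a rational
point near `y₀`, and by compactness finitely many boxes with upper bounds below the right end cover
the union. -/
theorem exists_valueCheck_iff (hN : N.IsDifferentiable) {x : UnionCode} {y₀ : Fin (w 0) → ℝ}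
    (hy₀ : y₀ ∈ unionVal (w 0) x) (hmax : ∀ z ∈ unionVal (w 0) x, N.gradNorm z ≤ N.gradNorm y₀)
    (e : IntervalCode) : (∃ c, ValueCheck N.info (arch H w) x e c) ↔
      WayBelow (boxVal ratVal e) (IDom.point (N.gradNorm y₀)) := by
  rcases e with _ | ⟨p, q⟩
  · exact ⟨fun _ => IDom.wayBelow_of_subset_interior (by simp [boxVal, IDom.bot]),
      fun _ => ⟨default, .inl rfl⟩⟩
  constructor
  · rintro ⟨c, h⟩
    obtain ⟨h1, h2, h3, h4⟩ := h.resolve_left (by simp)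
    obtain ⟨hy, hlo⟩ := pointCheck_sound hN h1
    have hlo' := hlo.trans (hmax _ hy)
    obtain ⟨b, hb, hyb⟩ := mem_unionVal.1 hy₀
    rw [getD_arch w (Nat.zero_le H)] at h3
    obtain ⟨b', hb', hyb'⟩ := h3.sound hb hyb
    obtain ⟨a, ha, rfl⟩ := List.mem_map.1 hb'
    obtain ⟨h5, h6⟩ := h4 a ha
    have hhi := (certifies_sound hN (archCertifies_arch.1 h5) hyb').2
    rw [← archHi_arch] at hhi
    -- The end points of a code are unordered, so the box runs from their infimum to their supremum;
    -- the alternatives in the check express comparison with these.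
    refine IDom.wayBelow_of_subset_interior (singleton_subset_iff.2
      (interior_maximal Ioo_subset_Icc_self isOpen_Ioo ⟨inf_lt_iff.2 ?_, lt_sup_iff.2 ?_⟩))
    · exact h2.imp hlo'.trans_lt' hlo'.trans_lt'
    · exact h6.imp hhi.trans_lt hhi.trans_lt
  · intro h
    have hm := IDom.mem_interior_of_wayBelow_point h
    have hm' : N.gradNorm y₀ ∈ Ioo (ratVal p ⊓ ratVal q) (ratVal p ⊔ ratVal q) := by
      rw [← interior_Icc]; exact hm
    obtain ⟨y, T, g₁, h1, h2⟩ := exists_pointCheck hN hy₀ hm'.1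
    obtain ⟨L, hL, hX⟩ := exists_list_of_isCompact (β := BoxPair × Cert) Prod.fst
      (P := fun a => ArchCertifies N.info (arch H w) a.1 a.2 ∧
        ratVal (archHi (arch H w) a.2) < ratVal p ⊔ ratVal q) (isCompact_unionVal (w 0) x)
      fun z hz => by
        obtain ⟨b, T, hb⟩ := exists_certified_box hN z ((hmax z hz).trans_lt hm'.2)
        exact ⟨(b, T), hb⟩
    obtain ⟨g₂, h3⟩ := exists_cover (n := w 0) (Xs := x.1 :: x.2) (Ls := L.map Prod.fst)
      fun b hb z hz => by
        obtain ⟨a, ha, haz⟩ := hX z (mem_unionVal.2 ⟨b, hb, hz⟩)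
        exact ⟨a.1, List.mem_map_of_mem ha, fun j => (haz j).inI⟩
    refine ⟨(y, T, L, g₁, g₂), .inr ⟨h1, inf_lt_iff.1 h2, ?_, fun a ha =>
      ⟨(hL a ha).1, lt_sup_iff.1 (hL a ha).2⟩⟩⟩
    rwa [getD_arch w (Nat.zero_le H)]

/-- Soundness: a maximiser cannot lie in a box whose upper bound is below a value attained on the
union, so it lies in a box strictly inside a larger box contained in `k`. Completeness: outside the
interior of `k` the norm stays below some `s` less than the maximum, so points there have boxes that
can be discarded, while points of the interior have nested boxes within `k`. -/
theorem exists_setCheck_iff (hN : N.IsDifferentiable) {x : UnionCode} {y₀ : Fin (w 0) → ℝ}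
    (hy₀ : y₀ ∈ unionVal (w 0) x) (hmax : ∀ z ∈ unionVal (w 0) x, N.gradNorm z ≤ N.gradNorm y₀)
    {K : KDom (Fin (w 0) → ℝ)}
    (hK : K.carrier = {z ∈ unionVal (w 0) x | N.gradNorm z = N.gradNorm y₀})
    (hKc : IsCompact K.carrier)
    (k : Option UnionCode) : (∃ c, SetCheck N.info (arch H w) x k c) ↔
      WayBelow (compactVal (w 0) k) K := by
  rcases k with _ | k
  · exact ⟨fun _ => KDom.wayBelow_of_subset_interior (by simp [compactVal]),
      fun _ => ⟨default, .inl rfl⟩⟩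
  constructor
  · rintro ⟨c, h⟩
    obtain ⟨h1, h2, h3, h4⟩ := h.resolve_left (by simp)
    obtain ⟨hy, hlo⟩ := pointCheck_sound hN h1
    rw [getD_arch w (Nat.zero_le H)] at h2 h3 h4
    refine KDom.wayBelow_of_subset_interior fun z hz => ?_
    rw [hK] at hz
    obtain ⟨b, hb, hzb⟩ := mem_unionVal.1 hz.1
    obtain ⟨b', hb', hzb'⟩ := h2.sound hb hzb
    obtain ⟨a, ha, rfl⟩ := List.mem_map.1 hb'
    rcases h3 a ha with ⟨h5, h6⟩ | h5
    · have hhi := (certifies_sound hN (archCertifies_arch.1 h5) hzb').2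
      rw [← archHi_arch, hz.2] at hhi
      exact absurd ((hlo.trans (hmax _ hy)).trans hhi) (not_le.2 h6)
    · refine interior_mono ?_ (mem_interior_boxVal_vec (b := a.2.2) fun j =>
        (h5 j j.2).btw (hzb' j))
      intro v hv
      exact mem_unionVal.2 (h4.sound (List.mem_map_of_mem (f := fun a => a.2.2) ha)
        (mem_boxVal_vec.1 hv))
  · intro h
    have hsub := KDom.subset_interior_of_wayBelow (hK ▸ ⟨y₀, hy₀, rfl⟩) hKc h
    have hcpt : IsCompact (unionVal (w 0) x \ interior (unionVal (w 0) k)) :=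
      (isCompact_unionVal _ _).diff isOpen_interior
    -- The part of the union outside the interior of `k` is compact and contains no maximiser, so
    -- the norm there is separated from the maximum; if that part is empty, any smaller number
    -- serves.
    obtain ⟨s, hs, hlt⟩ : ∃ s < N.gradNorm y₀,
        ∀ z ∈ unionVal (w 0) x \ interior (unionVal (w 0) k), N.gradNorm z < s := by
      rcases (unionVal (w 0) x \ interior (unionVal (w 0) k)).eq_empty_or_nonempty with he | hne
      · exact ⟨N.gradNorm y₀ - 1, by linarith, by simp [he]⟩
      · obtain ⟨z, hz, hzmax⟩ := hcpt.exists_isMaxOn hne hN.continuous_gradNorm.continuousOn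
        have hz' : N.gradNorm z < N.gradNorm y₀ := by
          refine lt_of_le_of_ne (hmax z hz.1) fun he => hz.2 (hsub ?_)
          rw [hK]; exact ⟨hz.1, he⟩
        obtain ⟨s, h1, h2⟩ := exists_between hz'
        exact ⟨s, h2, fun v hv => (hzmax hv).trans_lt h1⟩
    obtain ⟨y, T, g₁, h1, h2⟩ := exists_pointCheck hN hy₀ hs
    obtain ⟨L, hL, hX⟩ := exists_list_of_isCompact (β := BoxPair × Cert × BoxPair) (fun a => a.1)
      (P := fun a => ((ArchCertifies N.info (arch H w) a.1 a.2.1 ∧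
          ratVal (archHi (arch H w) a.2.1) < ratVal (archLo (arch H w) T)) ∨
          ∀ j < w 0, Inside (side a.1 j) (side a.2.2 j)) ∧
        ∀ z : Fin (w 0) → ℝ, InBox (w 0) a.2.2 z → z ∈ unionVal (w 0) k)
      (isCompact_unionVal (w 0) x) fun z hz => by
        by_cases hzk : z ∈ interior (unionVal (w 0) k)
        · obtain ⟨r, hr, hball⟩ := Metric.mem_nhds_iff.1 (mem_interior_iff_mem_nhds.1 hzk)
          choose I J hI hIJ hJ using fun j => exists_inside (z j) hr
          obtain ⟨b, hb⟩ := exists_box (w 0) (P := fun j I' => I' = I j) fun j => ⟨I j, rfl⟩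
          obtain ⟨b', hb'⟩ := exists_box (w 0) (P := fun j J' => J' = J j) fun j => ⟨J j, rfl⟩
          refine ⟨(b, default, b'), fun j => ?_, .inr fun j hj => ?_, fun v hv => hball ?_⟩
          · dsimp only; rw [hb j]; exact hI j
          · dsimp only; rw [hb ⟨j, hj⟩, hb' ⟨j, hj⟩]; exact hIJ ⟨j, hj⟩
          · refine (dist_pi_lt_iff hr).2 fun j => (hv j).abs_sub_lt ?_
            dsimp only; rw [hb' j]; exact hJ j
        · obtain ⟨b, T', hb, hT', hhi⟩ := exists_certified_box hN z (hlt z ⟨hz, hzk⟩)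
          -- The last condition of the check asks that every larger box lie in `k`, even for
          -- discarded boxes; `k.1` is a harmless choice.
          exact ⟨(b, T', k.1), hb, .inl ⟨hT', hhi.trans h2⟩,
            fun v hv => mem_unionVal.2 ⟨k.1, by simp, hv⟩⟩
    obtain ⟨g₂, h3⟩ := exists_cover (n := w 0) (Xs := x.1 :: x.2) (Ls := L.map fun a => a.1)
      fun b hb z hz => by
        obtain ⟨a, ha, haz⟩ := hX z (mem_unionVal.2 ⟨b, hb, hz⟩)
        exact ⟨a.1, List.mem_map_of_mem (f := fun a => a.1) ha, fun j => (haz j).inI⟩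
    obtain ⟨g₃, h4⟩ := exists_cover (n := w 0) (Xs := L.map fun a => a.2.2) (Ls := k.1 :: k.2)
      fun b hb z hz => by
        obtain ⟨a, ha, rfl⟩ := List.mem_map.1 hb
        exact mem_unionVal.1 ((hL a ha).2 z hz)
    refine ⟨(y, T, L, g₁, g₂, g₃), .inr ⟨h1, ?_, ?_, ?_⟩⟩ <;> rw [getD_arch w (Nat.zero_le H)]
    · exact h3
    · exact fun a ha => (hL a ha).1
    · exact h4

end Network

/-- Finitely many rational boxes, each with its sides close to a point of `K`, contain `K` in the
union of their interiors. Non-emptiness of `K` supplies the first box that a code requires. -/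
theorem exists_compactVal_subset_thickening {n : ℕ} {K : KDom (Fin n → ℝ)}
    (hne : K.carrier.Nonempty) (hK : IsCompact K.carrier) {ε : ℝ} (hε : 0 < ε) :
    ∃ c : UnionCode, WayBelow (compactVal n (some c)) K ∧
      unionVal n c ⊆ Metric.thickening ε K.carrier := by
  obtain ⟨L, hL, hcov⟩ := exists_list_of_isCompact (β := BoxPair) id
    (P := fun b => ∃ x ∈ K.carrier, ∀ j : Fin n, Near ε (side b j) (x j)) hK fun x hx => by
      obtain ⟨b, hb⟩ := exists_box _ fun j => exists_near_btw (x j) hε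
      exact ⟨b, fun j => (hb j).2.1, x, hx, fun j => (hb j).1⟩
  rcases L with _ | ⟨b, L⟩
  · obtain ⟨x, hx⟩ := hne
    obtain ⟨a, ha, -⟩ := hcov x hx
    simp at ha
  refine ⟨(b, L), KDom.wayBelow_of_subset_interior fun x hx => ?_, fun x hx => ?_⟩
  · obtain ⟨a, ha, hxa⟩ := hcov x hx
    refine interior_mono ?_ (mem_interior_boxVal_vec hxa)
    exact fun z hz => mem_unionVal.2 ⟨a, ha, mem_boxVal_vec.1 hz⟩
  · obtain ⟨a, ha, hxa⟩ := mem_unionVal.1 hx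
    obtain ⟨z, hz, hnear⟩ := hL a ha
    exact Metric.mem_thickening_iff.2 ⟨z, hz,
      (dist_pi_lt_iff hε).2 fun j => (hxa j).abs_sub_lt (hnear j)⟩

end LipNet

/-! ### The theorem -/

theorem mainTheorem4 :
    (∀ (H : ℕ) (w : ℕ → ℕ) (N : LipNet.Network H w), N.InF → N.IsDifferentiable →
      ∀ M : ℝ, 0 < M → ∀ X : Set (Fin (w 0) → ℝ), X.Nonempty → IsCompact X →
        X ⊆ Set.Icc (fun _ => -M) (fun _ => M) →
          LipNet.maxV N.clarkeNorm X = LipNet.maxV N.LtildeNorm X ∧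
          LipNet.maxS N.clarkeNorm X = LipNet.maxS N.LtildeNorm X) ∧
    (∃ (RV : List LipNet.Fact × (List ℕ × LipNet.UnionCode × LipNet.IntervalCode) → Prop)
        (RS : List LipNet.Fact × (List ℕ × LipNet.UnionCode × Option LipNet.UnionCode) → Prop),
      REPred RV ∧ REPred RS ∧
      ∀ (H : ℕ) (w : ℕ → ℕ) (N : LipNet.Network H w), N.InF → N.IsDifferentiable →
        ∀ M : ℝ, 0 < M → ∀ x : LipNet.UnionCode,
          LipNet.unionVal (w 0) x ⊆ Set.Icc (fun _ => -M) (fun _ => M) →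
          ∃ (v : LipNet.IDom ℝ) (K : LipNet.KDom (Fin (w 0) → ℝ)),
            v.carrier = LipNet.maxV N.clarkeNorm (LipNet.unionVal (w 0) x) ∧
            K.carrier = LipNet.maxS N.clarkeNorm (LipNet.unionVal (w 0) x) ∧
            (∀ e : LipNet.IntervalCode,
              (LipNet.arch H w, x, e) ∈ LipNet.outputs RV N.info ↔
                LipNet.WayBelow (LipNet.boxVal LipNet.ratVal e) v) ∧
            (∀ c : Option LipNet.UnionCode,
              (LipNet.arch H w, x, c) ∈ LipNet.outputs RS N.info ↔
                LipNet.WayBelow (LipNet.compactVal (w 0) c) K) ∧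
            ∀ ε : ℝ, 0 < ε →
              (∃ p q : LipNet.RatCode,
                LipNet.WayBelow (LipNet.boxVal LipNet.ratVal (some (p, q))) v ∧
                |LipNet.ratVal p - LipNet.ratVal q| < ε) ∧
              (∃ c : LipNet.UnionCode,
                LipNet.WayBelow (LipNet.compactVal (w 0) (some c)) K ∧
                LipNet.unionVal (w 0) c ⊆ Metric.thickening ε K.carrier)) := by
  refine ⟨fun H w N _ hN M _ X _ _ _ => ?_, LipNet.ValueGraph, LipNet.SetGraph,
    LipNet.rePred_valueGraph, LipNet.rePred_setGraph, fun H w N _ hN M _ x _ => ?_⟩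
  -- Both norms are the same singleton-valued function, so their maximum values and maximum sets
  -- coincide.
  · rw [hN.clarkeNorm_eq, hN.LtildeNorm_eq]
    exact ⟨rfl, rfl⟩
  · obtain ⟨y₀, hy₀, hmax⟩ := (LipNet.isCompact_unionVal (w 0) x).exists_isMaxOn
      (LipNet.unionVal_nonempty (w 0) x) hN.continuous_gradNorm.continuousOn
    have hmax' : ∀ z ∈ LipNet.unionVal (w 0) x, N.gradNorm z ≤ N.gradNorm y₀ :=
      fun z hz => hmax hz
    have hKc : IsCompact {z ∈ LipNet.unionVal (w 0) x | N.gradNorm z = N.gradNorm y₀} :=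
      (LipNet.isCompact_unionVal (w 0) x).inter_right
        (isClosed_eq hN.continuous_gradNorm continuous_const)
    have hKne : {z ∈ LipNet.unionVal (w 0) x | N.gradNorm z = N.gradNorm y₀}.Nonempty :=
      ⟨y₀, hy₀, rfl⟩
    -- By continuity and compactness the maximum is attained at `y₀`, so the maximum value is a
    -- maximal element and the maximum set is a non-empty closed part of the union.
    refine ⟨LipNet.IDom.point (N.gradNorm y₀), ⟨_, Or.inr ⟨hKne, hKc⟩⟩, ?_, ?_, fun e => ?_,
      fun c => ?_, fun ε hε => ⟨?_, LipNet.exists_compactVal_subset_thickening hKne hKc hε⟩⟩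
    · rw [hN.clarkeNorm_eq, LipNet.maxV_singleton hy₀ hmax']
      rfl
    · rw [hN.clarkeNorm_eq, LipNet.maxS_singleton hy₀ hmax']
    · rw [LipNet.mem_outputs_valueGraph]
      exact LipNet.Network.exists_valueCheck_iff hN hy₀ hmax' e
    · rw [LipNet.mem_outputs_setGraph]
      exact LipNet.Network.exists_setCheck_iff hN hy₀ hmax' rfl hKc c
    · obtain ⟨I, ⟨h1, h2⟩, h3, -⟩ := LipNet.exists_near_btw (N.gradNorm y₀) (half_pos hε)
      refine ⟨I.1, I.2, LipNet.Network.wayBelow_of_btw h3, ?_⟩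
      have := abs_sub_le (LipNet.ratVal I.1) (N.gradNorm y₀) (LipNet.ratVal I.2)
      rw [abs_sub_comm (N.gradNorm y₀)] at this
      linarith
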